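/- Let $n \ge 1$ and let $M$ be a compact complex manifold with $C^\infty$ boundary, $\dim_{\mathbb C} M = n$; that is, $M$ is a compact Hausdorff smooth real $2n$-dimensional manifold with (possibly empty) boundary $\partial M$, with an almost complex structure $J$ that is smooth up to $\partial M$ and is induced, near every interior point, by complex coordinate systems. $M$ need not be connected. Let $C^\infty(M)$ be the space of complex-valued functions smooth up to the boundary, and let \[ \mathcal O(M) = \{ f \in C^\infty(M) : f \text{ is holomorphic in } M^{\mathrm{int}} \}. \] Assume that (a) $M$ is holomorphically separable: for all $x \ne y$ in $M$ there is $f \in \mathcal O(M)$ with $f(x) \neq f(y)$; (b) $M$ has local charts given by global holomorphic functions: for every $p \in M$ (boundary points included) there are $f_1,\dots,f_n \in \mathcal O(M)$ which form a complex coordinate system near $p$. Let $g$ be any Kähler metric on $M$, i.e. a Riemannian metric, smooth up to the boundary, with $g(Jv,Jw) = g(v,w)$ for all tangent vectors $v,w$ and $\nabla J = 0$ for the Levi-Civita connection $\nabla$ of $g$. Let $\Delta_g$ be its Laplace–Beltrami operator and $dV_g$ its Riemannian volume measure. If $f \in C^\infty(M)$ vanishes to infinite order at $\partial M$ (all derivatives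 of all orders $\ge 0$ vanish at every point of $\partial M$) and \[ \int_M f u_1 u_2 \, dV_g = 0 \] for all $u_1, u_2 \in C^\infty(M)$ satisfying $\Delta_g u_1 = \Delta_g u_2 = 0$ in $M$, then $f \equiv 0$. -/

import Mathlib

open MeasureTheory Set
open scoped Manifold ContDiff Topology Bundle

noncomputable section

namespace KahlerCalderon

variable {n : ℕ} [NeZero n] {M : Type*} [TopologicalSpace M]
  [ChartedSpace (EuclideanHalfSpace (2 * n)) M]

/-- The `i`-th standard basis vector of `ℝ²ⁿ`. -/
abbrev stdVec (n : ℕ) (i : Fin (2 * n)) : EuclideanSpace ℝ (Fin (2 * n)) :=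
  EuclideanSpace.single i 1

/-- The `i`-th partial derivative, at the point `y` of the closed half-space, of a function on the
closed half-space of `ℝ²ⁿ` (at boundary points of the half-space this is the derivative from
inside). -/
def partialDeriv (n : ℕ) [NeZero n] {F : Type*} [NormedAddCommGroup F] [NormedSpace ℝ F]
    (i : Fin (2 * n)) (u : EuclideanSpace ℝ (Fin (2 * n)) → F)
    (y : EuclideanSpace ℝ (Fin (2 * n))) : F :=
  fderivWithin ℝ u (range (𝓡∂ (2 * n))) y (stdVec n i)

/-- The differential at `p` of a function on `M` with values in a real vector space `F`. -/
def differential {F : Type*} [NormedAddCommGroup F] [NormedSpace ℝ F] (u : M → F) (p : M) :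
    TangentSpace (𝓡∂ (2 * n)) p →L[ℝ] F :=
  mfderiv (𝓡∂ (2 * n)) 𝓘(ℝ, F) u p

/-- Complex-valued functions that are smooth up to the boundary. -/
def Smooth (n : ℕ) [NeZero n] {M : Type*} [TopologicalSpace M]
    [ChartedSpace (EuclideanHalfSpace (2 * n)) M] (u : M → ℂ) : Prop :=
  ContMDiff (𝓡∂ (2 * n)) 𝓘(ℝ, ℂ) ∞ u

/-! ### Complex structures on manifolds with boundary -/

/-- For a field `J` of endomorphisms of the (real) tangent spaces, `z = (z₁, …, zₙ)` is a complex
coordinate system on the open set `U`: the map `z : U → ℂⁿ` is smooth (up to the boundary),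
injective, has bijective real differential at each point, and satisfies the Cauchy–Riemann
equations `dz ∘ J = i dz`. -/
structure IsComplexChartOn (J : ∀ p : M, TangentSpace (𝓡∂ (2 * n)) p →L[ℝ]
    TangentSpace (𝓡∂ (2 * n)) p) (z : M → (Fin n → ℂ)) (U : Set M) : Prop where
  isOpen : IsOpen U
  smooth : ContMDiffOn (𝓡∂ (2 * n)) 𝓘(ℝ, Fin n → ℂ) ∞ z U
  injOn : InjOn z U
  bijective : ∀ q ∈ U, Function.Bijective (differential (n := n) z q)
  cauchyRiemann : ∀ q ∈ U, ∀ v : TangentSpace (𝓡∂ (2 * n)) q,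
    differential z q (J q v) = Complex.I • differential z q v

/-- A complex structure on the smooth real `2n`-dimensional manifold with boundary `M`: the
canonical almost complex structure `J`, smooth up to the boundary, such that the interior is
covered by complex coordinate systems. (Two such coordinate systems differ by a map whose
differential commutes with `i`, that is by a holomorphic map.) Complex coordinates near boundary
points are not required. -/
structure ComplexStructure (n : ℕ) [NeZero n] (M : Type*) [TopologicalSpace M]
    [ChartedSpace (EuclideanHalfSpace (2 * n)) M] [IsManifold (𝓡∂ (2 * n)) ∞ M] where
  J : ∀ p : M, TangentSpace (𝓡∂ (2 * n)) p →L[ℝ] TangentSpace (𝓡∂ (2 * n)) p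
  J_sq : ∀ (p : M) (v : TangentSpace (𝓡∂ (2 * n)) p), J p (J p v) = -v
  smooth : ContMDiff (𝓡∂ (2 * n))
    ((𝓡∂ (2 * n)).prod 𝓘(ℝ, EuclideanSpace ℝ (Fin (2 * n)) →L[ℝ] EuclideanSpace ℝ (Fin (2 * n))))
    ∞ (fun p : M ↦ Bundle.TotalSpace.mk'
      (E := fun p : M ↦ TangentSpace (𝓡∂ (2 * n)) p →L[ℝ] TangentSpace (𝓡∂ (2 * n)) p)
      (EuclideanSpace ℝ (Fin (2 * n)) →L[ℝ] EuclideanSpace ℝ (Fin (2 * n))) p (J p))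
  exists_chart : ∀ p ∈ (𝓡∂ (2 * n)).interior M, ∃ (z : M → (Fin n → ℂ)) (U : Set M),
    p ∈ U ∧ IsComplexChartOn J z U

section complex

variable [IsManifold (𝓡∂ (2 * n)) ∞ M]

/-- The algebra `𝒪(M)`: functions smooth up to the boundary which are holomorphic in the interior,
i.e. satisfy the Cauchy–Riemann equations `df ∘ J = i df` there. -/
def ComplexStructure.holomorphicFunctions (S : ComplexStructure n M) : Set (M → ℂ) :=
  {f | Smooth n f ∧ ∀ p ∈ (𝓡∂ (2 * n)).interior M, ∀ v : TangentSpace (𝓡∂ (2 * n)) p,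
    differential f p (S.J p v) = Complex.I * differential f p v}

/-- Global holomorphic functions separate points. -/
def ComplexStructure.HolomorphicallySeparable (S : ComplexStructure n M) : Prop :=
  ∀ x y : M, x ≠ y → ∃ f ∈ S.holomorphicFunctions, f x ≠ f y

/-- Near every point (boundary points included) some `n` global holomorphic functions form a
complex coordinate system. -/
def ComplexStructure.HasGlobalHolomorphicCharts (S : ComplexStructure n M) : Prop :=
  ∀ p : M, ∃ f : Fin n → M → ℂ, (∀ j, f j ∈ S.holomorphicFunctions) ∧
    ∃ U : Set M, p ∈ U ∧ IsComplexChartOn S.J (fun q j ↦ f j q) U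

end complex

/-! ### Riemannian metrics in coordinates -/

section metric

variable [IsManifold (𝓡∂ (2 * n)) ∞ M]

variable (n M) in
/-- Riemannian metrics on `M`, smooth up to the boundary. -/
abbrev Metric : Type _ :=
  Bundle.ContMDiffRiemannianMetric (𝓡∂ (2 * n)) ∞ (EuclideanSpace ℝ (Fin (2 * n)))
    (fun p : M ↦ TangentSpace (𝓡∂ (2 * n)) p)

/-- The coordinate vector field `∂/∂xᵢ` of the preferred chart around `p`, at the point with
coordinates `y`. -/
def coordVec (p : M) (y : EuclideanSpace ℝ (Fin (2 * n))) (i : Fin (2 * n)) :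
    TangentSpace (𝓡∂ (2 * n)) ((extChartAt (𝓡∂ (2 * n)) p).symm y) :=
  mfderivWithin 𝓘(ℝ, EuclideanSpace ℝ (Fin (2 * n))) (𝓡∂ (2 * n))
    (extChartAt (𝓡∂ (2 * n)) p).symm (range (𝓡∂ (2 * n))) y (stdVec n i)

/-- The matrix `gᵢⱼ = g(∂/∂xᵢ, ∂/∂xⱼ)` in the preferred chart around `p`. -/
def metricCoord (g : Metric n M) (p : M) (y : EuclideanSpace ℝ (Fin (2 * n))) :
    Matrix (Fin (2 * n)) (Fin (2 * n)) ℝ :=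
  Matrix.of fun i j ↦ g.inner ((extChartAt (𝓡∂ (2 * n)) p).symm y) (coordVec p y i) (coordVec p y j)

/-- The Christoffel symbol `Γᵏᵢⱼ` of the Levi-Civita connection of `g` in the preferred chart
around `p`. -/
def christoffel (g : Metric n M) (p : M) (k i j : Fin (2 * n))
    (y : EuclideanSpace ℝ (Fin (2 * n))) : ℝ :=
  (1 / 2) * ∑ l, (metricCoord g p y)⁻¹ k l *
    (partialDeriv n i (fun x ↦ metricCoord g p x j l) y +
      partialDeriv n j (fun x ↦ metricCoord g p x i l) y -
      partialDeriv n l (fun x ↦ metricCoord g p x i j) y)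

/-- The components `Jᵏⱼ` of the almost complex structure in the preferred chart around `p`:
`J(∂/∂xⱼ) = ∑ₖ Jᵏⱼ ∂/∂xₖ`. -/
def complexCoord (S : ComplexStructure n M) (p : M) (k j : Fin (2 * n))
    (y : EuclideanSpace ℝ (Fin (2 * n))) : ℝ :=
  differential (extChartAt (𝓡∂ (2 * n)) p) ((extChartAt (𝓡∂ (2 * n)) p).symm y)
    (S.J ((extChartAt (𝓡∂ (2 * n)) p).symm y) (coordVec p y j)) k

/-- The components `(∇ᵢ J)ᵏⱼ` of the Levi-Civita covariant derivative of `J` in the preferred chart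
around `p`. -/
def covDerivJ (S : ComplexStructure n M) (g : Metric n M) (p : M) (i k j : Fin (2 * n))
    (y : EuclideanSpace ℝ (Fin (2 * n))) : ℝ :=
  partialDeriv n i (complexCoord S p k j) y +
    ∑ l, (christoffel g p k i l y * complexCoord S p l j y -
      christoffel g p l i j y * complexCoord S p k l y)

/-- `g` is a Kähler metric: it is compatible with `J`, and `∇J = 0` for its Levi-Civita
connection. -/
structure IsKahler (S : ComplexStructure n M) (g : Metric n M) : Prop where
  compatible : ∀ (p : M) (v w : TangentSpace (𝓡∂ (2 * n)) p),
    g.inner p (S.J p v) (S.J p w) = g.inner p v w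
  parallel : ∀ (p : M) (i k j : Fin (2 * n)),
    covDerivJ S g p i k j (extChartAt (𝓡∂ (2 * n)) p p) = 0

/-- The (positive) Laplace–Beltrami operator
`Δ_g u = - |g|^{-1/2} ∑ᵢⱼ ∂ᵢ (|g|^{1/2} gⁱʲ ∂ⱼ u)`, at `p` computed in the preferred chart around
`p`. -/
def laplacian (g : Metric n M) (u : M → ℂ) (p : M) : ℂ :=
  -(((√(metricCoord g p (extChartAt (𝓡∂ (2 * n)) p p)).det)⁻¹ : ℝ) : ℂ) *
    ∑ i, ∑ j, partialDeriv n i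
      (fun y ↦ ((√(metricCoord g p y).det * (metricCoord g p y)⁻¹ i j : ℝ) : ℂ) *
        partialDeriv n j (fun x ↦ u ((extChartAt (𝓡∂ (2 * n)) p).symm x)) y)
      (extChartAt (𝓡∂ (2 * n)) p p)

/-- The Riemannian volume measure of the domain of the preferred chart around `p`, that is the
measure `|g|^{1/2} dx` in these coordinates. -/
def chartVolume [MeasurableSpace M] (g : Metric n M) (p : M) : Measure M :=
  (((volume : Measure (EuclideanSpace ℝ (Fin (2 * n)))).restrict
      (extChartAt (𝓡∂ (2 * n)) p).target).withDensity
        (fun y ↦ ENNReal.ofReal √(metricCoord g p y).det)).map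
    (extChartAt (𝓡∂ (2 * n)) p).symm

/-- The Riemannian volume measure `dV_g`: the least measure that dominates the volume measures of
all chart domains. These agree on the overlaps of the chart domains, so the restriction of `dV_g`
to each chart domain is the volume measure of that domain. -/
def riemannianVolume [MeasurableSpace M] (g : Metric n M) : Measure M :=
  ⨆ p : M, chartVolume g p

end metric

/-- All derivatives of `f` (of every order `k ≥ 0`) vanish at every boundary point. -/
def VanishesToInfiniteOrderAtBoundary (n : ℕ) [NeZero n] {M : Type*} [TopologicalSpace M]
    [ChartedSpace (EuclideanHalfSpace (2 * n)) M] (f : M → ℂ) : Prop :=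
  ∀ p ∈ (𝓡∂ (2 * n)).boundary M, ∀ k : ℕ,
    iteratedFDerivWithin ℝ k (fun y ↦ f ((extChartAt (𝓡∂ (2 * n)) p).symm y))
      (range (𝓡∂ (2 * n))) (extChartAt (𝓡∂ (2 * n)) p p) = 0

end KahlerCalderon

end

noncomputable section

namespace KahlerCalderon

/-! ### Calculus of matrix-valued functions -/

section matrixCalculus

variable {ι : Type*} [Fintype ι] [DecidableEq ι]

/-! If u and v are holomorphic, then u and the conjugate of v are both harmonic for a Kähler metric,
so f is orthogonal to every product of a holomorphic and an antiholomorphic function. Holomorphic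
functions contain the constants, are closed under multiplication and separate points. Hence these
products span a unital, conjugation-invariant algebra that separates points, and it is dense in C(M)
by Stone–Weierstrass (`eq_zero_of_annihilates_holomorphic_mul_conj`). Integration against f is a
continuous functional, hence zero. Evaluating it at the conjugate of f gives ∫ |f|² = 0, and f
vanishes because nonempty open sets have positive volume.

Harmonicity (`laplacian_eq_zero_of_holomorphic`) is a trace argument. Up to sign, the Laplacian is
the g-trace of the covariant Hessian H of u (`sum_fderivWithin_divergence`). Differentiating du ∘ J
= i du with ∇J = 0 gives H(·, J·) = i H (`sum_covariantHessian_mul`). As H is symmetric, H(J·, J·) =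
-H, while g is J-invariant, so the trace equals its own negative (`sum_inv_mul_eq_zero_of_mul_eq`).
All derivatives are taken within the closed half-space, so the computation covers boundary points.

The volume, a supremum over charts, must be shown finite (`isFiniteMeasure_riemannianVolume`) and
positive on nonempty open sets (`riemannianVolume_pos`). -/

lemma hasDerivAt_det_add_smul (A B : Matrix ι ι ℝ) (hA : A.det ≠ 0) :
    HasDerivAt (fun t : ℝ ↦ (A + t • B).det) (A.det * (A⁻¹ * B).trace) 0 := by
  -- After factoring out `A`, the determinant of `1 + t • (A⁻¹ * B)` is a polynomial in `t` whose
  -- derivative at 0 is the trace of `A⁻¹ * B`.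
  have key : ∀ t : ℝ, (A + t • B).det = A.det *
      (Matrix.det (1 + (Polynomial.X : Polynomial ℝ) •
        (A⁻¹ * B).map Polynomial.C)).eval t := by
    intro t
    have h1 : A + t • B = A * (1 + t • (A⁻¹ * B)) := by
      rw [mul_add, mul_one, Matrix.mul_smul, ← mul_assoc,
        Matrix.mul_nonsing_inv _ (isUnit_iff_ne_zero.2 hA), one_mul]
    rw [h1, Matrix.det_mul, ← Polynomial.coe_evalRingHom, RingHom.map_det]
    congr 2
    ext i j
    simp only [RingHom.mapMatrix_apply, Matrix.map_apply, Matrix.add_apply, Matrix.smul_apply,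
      smul_eq_mul, Polynomial.coe_evalRingHom, Polynomial.eval_add, Polynomial.eval_mul,
      Polynomial.eval_X, Polynomial.eval_C, Matrix.one_apply]
    split_ifs <;> simp
  rw [funext key, ← Matrix.derivative_det_one_add_X_smul]
  exact (Polynomial.hasDerivAt _ _).const_mul _

variable {E : Type*} [NormedAddCommGroup E] [NormedSpace ℝ E] {s : Set E} {x : E}
  {G : E → Matrix ι ι ℝ}

lemma contDiffWithinAt_det {m : ℕ∞ω}
    (hG : ∀ i j, ContDiffWithinAt ℝ m (fun y ↦ G y i j) s x) :
    ContDiffWithinAt ℝ m (fun y ↦ (G y).det) s x := by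
  simp only [Matrix.det_apply]
  refine ContDiffWithinAt.sum fun σ _ ↦ ?_
  simp only [Units.smul_def, zsmul_eq_mul]
  exact contDiffWithinAt_const.mul (contDiffWithinAt_prod fun i _ ↦ hG _ _)

lemma contDiffWithinAt_inv {m : ℕ∞ω}
    (hG : ∀ i j, ContDiffWithinAt ℝ m (fun y ↦ G y i j) s x) (hdet : (G x).det ≠ 0) (i j : ι) :
    ContDiffWithinAt ℝ m (fun y ↦ (G y)⁻¹ i j) s x := by
  simp only [Matrix.inv_def, Matrix.smul_apply, Ring.inverse_eq_inv', smul_eq_mul,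
    Matrix.adjugate_apply]
  refine ((contDiffWithinAt_det hG).inv hdet).mul (contDiffWithinAt_det fun k l ↦ ?_)
  -- An adjugate entry is the determinant of `G` with row `j` replaced by a basis vector: entries in
  -- that row are constant, the others are entries of `G`.
  by_cases hk : k = j
  · subst hk
    simpa using contDiffWithinAt_const
  · simpa [Matrix.updateRow_ne hk] using hG k l

/-- The matrix of derivatives of the entries of `G` in the direction `v`. -/
def entryDeriv (G : E → Matrix ι ι ℝ) (s : Set E) (x v : E) : Matrix ι ι ℝ :=
  Matrix.of fun i j ↦ fderivWithin ℝ (fun y ↦ G y i j) s x v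

/-- Jacobi's formula. -/
lemma fderivWithin_det (hG : ∀ i j, DifferentiableWithinAt ℝ (fun y ↦ G y i j) s x)
    (hs : UniqueDiffWithinAt ℝ s x) (hdet : (G x).det ≠ 0) (v : E) :
    fderivWithin ℝ (fun y ↦ (G y).det) s x v =
      (G x).det * ((G x)⁻¹ * entryDeriv G s x v).trace := by
  let d : (ι → ι → ℝ) → ℝ := fun A ↦ (Matrix.of A).det
  have hd : Differentiable ℝ d := by
    intro A
    simp only [d, Matrix.det_apply, Units.smul_def, zsmul_eq_mul, Matrix.of_apply]
    fun_prop
  let G' : E →L[ℝ] (ι → ι → ℝ) := ContinuousLinearMap.pi fun i ↦ ContinuousLinearMap.pi fun j ↦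
    fderivWithin ℝ (fun y ↦ G y i j) s x
  let G₀ : E → (ι → ι → ℝ) := fun y i j ↦ G y i j
  have hG' : HasFDerivWithinAt G₀ G' s x := by
    refine hasFDerivWithinAt_pi.2 fun i ↦ hasFDerivWithinAt_pi.2 fun j ↦ ?_
    exact (hG i j).hasFDerivWithinAt
  have h1 := ((hd (G₀ x)).hasFDerivAt.comp_hasFDerivWithinAt x hG').fderivWithin hs
  have h2 : fderivWithin ℝ (fun y ↦ (G y).det) s x = (fderiv ℝ d (G₀ x)).comp G' := h1
  rw [h2, ContinuousLinearMap.comp_apply]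
  -- The chain rule leaves the derivative of `d` in the single direction `G' v`; it is computed
  -- along a line, where uniqueness of derivatives identifies it with the trace formula.
  have hline : HasDerivAt (fun t : ℝ ↦ G₀ x + t • G' v) (G' v) 0 := by
    simpa using ((hasDerivAt_id (0 : ℝ)).smul_const (G' v)).const_add (G₀ x)
  have h3 : HasFDerivAt d (fderiv ℝ d (G₀ x)) (G₀ x + (0 : ℝ) • G' v) := by
    simpa using (hd (G₀ x)).hasFDerivAt
  exact (h3.comp_hasDerivAt (0 : ℝ) hline).unique
    (hasDerivAt_det_add_smul (G x) (entryDeriv G s x v) hdet)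

set_option linter.unusedSectionVars false in
lemma entryDeriv_mul {A B : E → Matrix ι ι ℝ}
    (hA : ∀ i j, DifferentiableWithinAt ℝ (fun y ↦ A y i j) s x)
    (hB : ∀ i j, DifferentiableWithinAt ℝ (fun y ↦ B y i j) s x)
    (hs : UniqueDiffWithinAt ℝ s x) (v : E) :
    entryDeriv (fun y ↦ A y * B y) s x v =
      entryDeriv A s x v * B x + A x * entryDeriv B s x v := by
  ext i j
  simp only [entryDeriv, Matrix.of_apply, Matrix.mul_apply, Matrix.add_apply]
  rw [fderivWithin_fun_sum hs fun k _ ↦ (hA i k).fun_mul (hB k j), sum_apply,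
    ← Finset.sum_add_distrib]
  refine Finset.sum_congr rfl fun k _ ↦ ?_
  rw [fderivWithin_fun_mul hs (hA i k) (hB k j)]
  simp only [add_apply, smul_apply, smul_eq_mul]
  ring

/-- Differentiate `G * G⁻¹ = 1`. That `G⁻¹` is differentiable at all comes from Cramer's rule,
through `contDiffWithinAt_inv`. -/
lemma entryDeriv_inv (hG : ∀ i j, ContDiffWithinAt ℝ 1 (fun y ↦ G y i j) s x)
    (hs : UniqueDiffWithinAt ℝ s x) (hx : x ∈ s) (hdet : ∀ᶠ y in 𝓝[s] x, (G y).det ≠ 0) (v : E) :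
    entryDeriv (fun y ↦ (G y)⁻¹) s x v = -((G x)⁻¹ * entryDeriv G s x v * (G x)⁻¹) := by
  have hdx : (G x).det ≠ 0 := hdet.self_of_nhdsWithin hx
  have hG1 : ∀ i j, DifferentiableWithinAt ℝ (fun y ↦ G y i j) s x :=
    fun i j ↦ (hG i j).differentiableWithinAt one_ne_zero
  have hI1 : ∀ i j, DifferentiableWithinAt ℝ (fun y ↦ (G y)⁻¹ i j) s x :=
    fun i j ↦ (contDiffWithinAt_inv hG hdx i j).differentiableWithinAt one_ne_zero
  have h1 := entryDeriv_mul hG1 hI1 hs v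
  have h2 : entryDeriv (fun y ↦ G y * (G y)⁻¹) s x v = 0 := by
    ext i j
    have : (fun y ↦ (G y * (G y)⁻¹) i j) =ᶠ[𝓝[s] x] fun _ ↦ (1 : Matrix ι ι ℝ) i j := by
      filter_upwards [hdet] with y hy
      rw [Matrix.mul_nonsing_inv _ (isUnit_iff_ne_zero.2 hy)]
    simp only [entryDeriv, Matrix.of_apply, Matrix.zero_apply]
    rw [this.fderivWithin_eq (this.self_of_nhdsWithin hx)]
    simp
  rw [h2] at h1
  have h3 : G x * entryDeriv (fun y ↦ (G y)⁻¹) s x v = -(entryDeriv G s x v * (G x)⁻¹) :=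
    (neg_eq_of_add_eq_zero_right h1.symm).symm
  have h4 := congrArg ((G x)⁻¹ * ·) h3
  simp only [← mul_assoc, Matrix.nonsing_inv_mul _ (isUnit_iff_ne_zero.2 hdx), one_mul,
    mul_neg] at h4
  exact h4

set_option linter.unusedSectionVars false in
/-- Contracting the Christoffel symbols with the inverse metric. -/
lemma sum_inv_mul_christoffel (A : Matrix ι ι ℝ) (hA : A.IsSymm) (dG : ι → Matrix ι ι ℝ)
    (k : ι) :
    ∑ i, ∑ j, A i j * ((1 / 2) * ∑ l, A k l * (dG i j l + dG j i l - dG l i j)) =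
      -∑ i, ((1 / 2) * (A * dG i).trace * A i k - (A * dG i * A) i k) := by
  have hA' : ∀ i j, A i j = A j i := fun i j ↦ hA.apply j i
  -- Of the three contractions of `dG`, the first two agree by exchanging `i` and `j` in the
  -- symmetric `A`, and together cancel the factor 1/2 to give the `A * dG * A` term. The third is
  -- the trace term.
  have h1 : ∑ i, ∑ j, ∑ l, A i j * A k l * dG j i l = ∑ i, ∑ j, ∑ l, A i j * A k l * dG i j l := by
    rw [Finset.sum_comm]
    refine Finset.sum_congr rfl fun i _ ↦ Finset.sum_congr rfl fun j _ ↦ ?_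
    rw [hA' i j]
  have h2 : ∑ i, (A * dG i * A) i k = ∑ i, ∑ j, ∑ l, A i j * A k l * dG i j l := by
    refine Finset.sum_congr rfl fun i _ ↦ ?_
    simp only [Matrix.mul_apply, Finset.sum_mul]
    rw [Finset.sum_comm]
    refine Finset.sum_congr rfl fun j _ ↦ Finset.sum_congr rfl fun l _ ↦ ?_
    rw [hA' k l]; ring
  have h3 : ∑ i, (A * dG i).trace * A i k = ∑ i, ∑ j, ∑ l, A i j * A k l * dG l i j := by
    have : ∑ i, ∑ j, ∑ l, A i j * A k l * dG l i j = ∑ l, ∑ j, ∑ i, A i j * A k l * dG l i j := by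
      rw [Finset.sum_comm]
      simp_rw [Finset.sum_comm (s := Finset.univ (α := ι)) (t := Finset.univ (α := ι))
        (f := fun i l ↦ A i _ * A k l * dG l i _)]
      rw [Finset.sum_comm]
    rw [this]
    refine Finset.sum_congr rfl fun i _ ↦ ?_
    simp only [Matrix.trace, Matrix.diag_apply, Matrix.mul_apply, Finset.sum_mul]
    refine Finset.sum_congr rfl fun j _ ↦ Finset.sum_congr rfl fun l _ ↦ ?_
    rw [hA' k i, hA' l j]; ring
  have h4 : ∑ i, ∑ j, A i j * ((1 / 2) * ∑ l, A k l * (dG i j l + dG j i l - dG l i j)) =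
      (1 / 2) * (∑ i, ∑ j, ∑ l, A i j * A k l * dG i j l + ∑ i, ∑ j, ∑ l, A i j * A k l * dG j i l
        - ∑ i, ∑ j, ∑ l, A i j * A k l * dG l i j) := by
    simp only [← Finset.sum_add_distrib, ← Finset.sum_sub_distrib, Finset.mul_sum]
    refine Finset.sum_congr rfl fun i _ ↦ Finset.sum_congr rfl fun j _ ↦
      Finset.sum_congr rfl fun l _ ↦ ?_
    ring
  rw [h4, h1, Finset.sum_sub_distrib, h2]
  simp only [mul_assoc (1 / 2 : ℝ), ← Finset.mul_sum, h3]
  ring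

/-- Derivative of the coefficients `|G|^{1/2} Gⁱʲ` of the divergence form Laplacian. -/
lemma fderivWithin_sqrt_det_mul_inv (hG : ∀ i j, ContDiffWithinAt ℝ 1 (fun y ↦ G y i j) s x)
    (hs : UniqueDiffWithinAt ℝ s x) (hx : x ∈ s) (hdet : ∀ᶠ y in 𝓝[s] x, (G y).det ≠ 0)
    (hpos : 0 < (G x).det) (v : E) (i j : ι) :
    fderivWithin ℝ (fun y ↦ √(G y).det * (G y)⁻¹ i j) s x v =
      √(G x).det * ((1 / 2) * ((G x)⁻¹ * entryDeriv G s x v).trace * (G x)⁻¹ i j -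
        ((G x)⁻¹ * entryDeriv G s x v * (G x)⁻¹) i j) := by
  have hd1 : DifferentiableWithinAt ℝ (fun y ↦ (G y).det) s x :=
    (contDiffWithinAt_det hG).differentiableWithinAt one_ne_zero
  have hI1 : DifferentiableWithinAt ℝ (fun y ↦ (G y)⁻¹ i j) s x :=
    (contDiffWithinAt_inv hG hpos.ne' i j).differentiableWithinAt one_ne_zero
  have hG1 : ∀ i j, DifferentiableWithinAt ℝ (fun y ↦ G y i j) s x :=
    fun i j ↦ (hG i j).differentiableWithinAt one_ne_zero
  have hinv : fderivWithin ℝ (fun y ↦ (G y)⁻¹ i j) s x v =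
      -((G x)⁻¹ * entryDeriv G s x v * (G x)⁻¹) i j :=
    congrFun (congrFun (entryDeriv_inv hG hs hx hdet v) i) j
  have hsq := (hd1.hasFDerivWithinAt.sqrt hpos.ne').fderivWithin hs
  rw [fderivWithin_fun_mul hs (hd1.sqrt hpos.ne') hI1]
  simp only [add_apply, smul_apply, smul_eq_mul, hinv, hsq,
    fderivWithin_det hG1 hs hpos.ne']
  have h0 : √(G x).det ≠ 0 := (Real.sqrt_pos.2 hpos).ne'
  have h1 : 1 / (2 * √(G x).det) * (G x).det = √(G x).det * (1 / 2) := by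
    field_simp
    rw [Real.sq_sqrt hpos.le]
  linear_combination (G x)⁻¹ i j * ((G x)⁻¹ * entryDeriv G s x v).trace * h1

set_option linter.unusedSectionVars false in
-- The divergence form produces first-order terms `T i j * w j`, the Hessian produces `A i j * Γ k i
-- j * w k`; the hypothesis `h` says exactly that they match. Here `T` stands for the derivative of
-- the coefficients divided by `|G|^{1/2}`.
lemma sum_hessian_trace (r : ℂ) (A T : Matrix ι ι ℝ) (Γ : ι → ι → ι → ℝ) (D : ι → ι → ℂ)
    (w : ι → ℂ) (h : ∀ k, ∑ i, ∑ j, A i j * Γ k i j = -∑ i, T i k) :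
    ∑ i, ∑ j, (r * (A i j : ℂ) * D i j + r * (T i j : ℂ) * w j) =
      r * ∑ i, ∑ j, (A i j : ℂ) * (D i j - ∑ k, (Γ k i j : ℂ) * w k) := by
  have h1 : ∑ i, ∑ j, (A i j : ℂ) * ∑ k, (Γ k i j : ℂ) * w k = -∑ i, ∑ j, (T i j : ℂ) * w j := by
    have h2 : ∑ i, ∑ j, (A i j : ℂ) * ∑ k, (Γ k i j : ℂ) * w k =
        ∑ k, (∑ i, ∑ j, (A i j : ℂ) * (Γ k i j : ℂ)) * w k := by
      simp only [Finset.mul_sum, Finset.sum_mul]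
      rw [Finset.sum_comm (s := Finset.univ (α := ι)) (t := Finset.univ (α := ι))
        (f := fun k i ↦ ∑ j, (A i j : ℂ) * (Γ k i j : ℂ) * w k)]
      refine Finset.sum_congr rfl fun i _ ↦ ?_
      rw [Finset.sum_comm]
      simp only [mul_assoc]
    rw [h2, Finset.sum_comm, ← Finset.sum_neg_distrib]
    refine Finset.sum_congr rfl fun k _ ↦ ?_
    have := congrArg (fun t : ℝ ↦ (t : ℂ)) (h k)
    push_cast at this
    rw [this, neg_mul, Finset.sum_mul]
  simp only [mul_sub, Finset.sum_sub_distrib, h1, Finset.sum_add_distrib, sub_neg_eq_add]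
  simp only [mul_add, mul_assoc, Finset.mul_sum]

/-- The Laplacian in divergence form is the trace of the covariant Hessian. -/
lemma sum_fderivWithin_divergence (hG : ∀ i j, ContDiffWithinAt ℝ 1 (fun y ↦ G y i j) s x)
    (hsymm : ∀ y, (G y).IsSymm)
    (hs : UniqueDiffWithinAt ℝ s x) (hx : x ∈ s) (hdet : ∀ᶠ y in 𝓝[s] x, (G y).det ≠ 0)
    (hpos : 0 < (G x).det) (e : ι → E) (w : ι → E → ℂ)
    (hw : ∀ j, DifferentiableWithinAt ℝ (w j) s x) :
    ∑ i, ∑ j, fderivWithin ℝ (fun y ↦ ((√(G y).det * (G y)⁻¹ i j : ℝ) : ℂ) * w j y) s x (e i) =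
      (√(G x).det : ℂ) * ∑ i, ∑ j, ((G x)⁻¹ i j : ℂ) * (fderivWithin ℝ (w j) s x (e i) -
        ∑ k, (((1 / 2) * ∑ l, (G x)⁻¹ k l * (fderivWithin ℝ (fun y ↦ G y j l) s x (e i) +
          fderivWithin ℝ (fun y ↦ G y i l) s x (e j) -
          fderivWithin ℝ (fun y ↦ G y i j) s x (e l)) : ℝ) : ℂ) * w k x) := by
  have hAs : ((G x)⁻¹).IsSymm := by
    rw [Matrix.IsSymm, Matrix.transpose_nonsing_inv, (hsymm x)]
  have hc : ∀ i j, DifferentiableWithinAt ℝ (fun y ↦ √(G y).det * (G y)⁻¹ i j) s x := fun i j ↦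
    (((contDiffWithinAt_det hG).differentiableWithinAt one_ne_zero).sqrt hpos.ne').mul
      ((contDiffWithinAt_inv hG hpos.ne' i j).differentiableWithinAt one_ne_zero)
  have hprod : ∀ i j,
      fderivWithin ℝ (fun y ↦ ((√(G y).det * (G y)⁻¹ i j : ℝ) : ℂ) * w j y) s x (e i) =
      (√(G x).det : ℂ) * ((G x)⁻¹ i j : ℂ) * fderivWithin ℝ (w j) s x (e i) +
      (√(G x).det : ℂ) * (((1 / 2) * ((G x)⁻¹ * entryDeriv G s x (e i)).trace * (G x)⁻¹ i j -
        ((G x)⁻¹ * entryDeriv G s x (e i) * (G x)⁻¹) i j : ℝ) : ℂ) * w j x := by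
    intro i j
    have h1 : HasFDerivWithinAt (fun y ↦ ((√(G y).det * (G y)⁻¹ i j : ℝ) : ℂ))
        (Complex.ofRealCLM.comp (fderivWithin ℝ (fun y ↦ √(G y).det * (G y)⁻¹ i j) s x)) s x :=
      Complex.ofRealCLM.hasFDerivAt.comp_hasFDerivWithinAt x (hc i j).hasFDerivWithinAt
    rw [(h1.fun_mul (hw j).hasFDerivWithinAt).fderivWithin hs]
    simp only [add_apply, smul_apply,
      ContinuousLinearMap.comp_apply, Complex.ofRealCLM_apply, smul_eq_mul,
      fderivWithin_sqrt_det_mul_inv hG hs hx hdet hpos]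
    push_cast
    ring
  simp only [hprod]
  exact sum_hessian_trace _ _ _ _ _ _ fun k ↦
    sum_inv_mul_christoffel ((G x)⁻¹) hAs (fun i ↦ entryDeriv G s x (e i)) k

/-- If `H` is symmetric with `H J = i H`, where `J` is a `g`-orthogonal complex structure, then
the `g`-trace of `H` vanishes. -/
lemma sum_inv_mul_eq_zero_of_mul_eq (g J : Matrix ι ι ℝ) (hg : g.det ≠ 0)
    (hJ : J * J = -1) (hgJ : J.transpose * g * J = g) (H : Matrix ι ι ℂ) (hH : H.IsSymm)
    (hHJ : H * J.map Complex.ofReal = Complex.I • H) :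
    ∑ i, ∑ j, (g⁻¹ i j : ℂ) * H i j = 0 := by
  have hgu : IsUnit g.det := isUnit_iff_ne_zero.2 hg
  have hJt : J.transpose * J.transpose = -1 := by
    rw [← Matrix.transpose_mul, hJ, Matrix.transpose_neg, Matrix.transpose_one]
  -- The dual metric is `J`-invariant as well: `Jᵀ g J = g` and `J² = -1` give `g J = -Jᵀ g`.
  have hinv : J * g⁻¹ * J.transpose = g⁻¹ := by
    have h1 : g * (J * g⁻¹ * J.transpose) = 1 := by
      have h2 : g * J = -(J.transpose * g) := by
        have := congrArg (J.transpose * ·) hgJ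
        simp only [← mul_assoc, hJt, neg_mul, one_mul] at this
        rw [← this, neg_neg]
      rw [← mul_assoc, ← mul_assoc, h2, neg_mul, neg_mul, mul_assoc J.transpose,
        Matrix.mul_nonsing_inv _ hgu, mul_one, hJt, neg_neg]
    exact (Matrix.inv_eq_right_inv h1).symm
  set Jc := J.map Complex.ofReal with hJc
  set A := (g⁻¹).map Complex.ofReal with hA
  have hAc : Jc * A * Jc.transpose = A := by
    have := congrArg (fun B : Matrix ι ι ℝ ↦ B.map Complex.ofRealHom) hinv
    simp only [Matrix.map_mul, Matrix.transpose_map] at this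
    exact this
  have hH' : Jc.transpose * H = Complex.I • H := by
    have := congrArg Matrix.transpose hHJ
    rwa [Matrix.transpose_mul, Matrix.transpose_smul, hH] at this
  have hJH : Jc.transpose * H * Jc = -H := by
    rw [hH', Matrix.smul_mul, hHJ, smul_smul, Complex.I_mul_I, neg_one_smul]
  -- Insert `A = J A Jᵀ` and move `J` around the trace: `A` then meets `Jᵀ H J`, which is `-H`.
  have htr : (A * H).trace = -(A * H).trace := by
    conv_lhs => rw [← hAc]
    rw [mul_assoc, mul_assoc, Matrix.trace_mul_comm, mul_assoc, mul_assoc, ← mul_assoc _ H, hJH,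
      mul_neg, Matrix.trace_neg]
  have h0 : (A * H).trace = 0 := self_eq_neg.1 htr
  rw [← h0, Matrix.trace]
  refine Finset.sum_congr rfl fun i _ ↦ ?_
  rw [Matrix.diag_apply, Matrix.mul_apply]
  refine Finset.sum_congr rfl fun j _ ↦ ?_
  rw [hA, Matrix.map_apply, hH.apply]

end matrixCalculus

end KahlerCalderon

end

noncomputable section

namespace KahlerCalderon

/-! ### Coordinate expressions in the preferred charts -/

section coordinates

variable {n : ℕ} [NeZero n] {M : Type*} [TopologicalSpace M]
  [ChartedSpace (EuclideanHalfSpace (2 * n)) M] [IsManifold (𝓡∂ (2 * n)) ∞ M]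

set_option linter.unusedSectionVars false in
lemma symm_mem_chart_source {p : M} {y : EuclideanSpace ℝ (Fin (2 * n))}
    (hy : y ∈ (extChartAt (𝓡∂ (2 * n)) p).target) :
    (extChartAt (𝓡∂ (2 * n)) p).symm y ∈ (chartAt (EuclideanHalfSpace (2 * n)) p).source := by
  rw [← extChartAt_source (𝓡∂ (2 * n))]
  exact (extChartAt (𝓡∂ (2 * n)) p).map_target hy

/-- The `i`-th coordinate vector field of the preferred chart around `p`, as a section of the
tangent bundle. -/
def coordSection (p : M) (i : Fin (2 * n)) (x : M) : TangentSpace (𝓡∂ (2 * n)) x :=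
  (trivializationAt (EuclideanSpace ℝ (Fin (2 * n))) (TangentSpace (𝓡∂ (2 * n))) p).symmL ℝ x
    (stdVec n i)

lemma coordVec_eq_coordSection {p : M} {y : EuclideanSpace ℝ (Fin (2 * n))}
    (hy : y ∈ (extChartAt (𝓡∂ (2 * n)) p).target) (i : Fin (2 * n)) :
    coordVec p y i = coordSection p i ((extChartAt (𝓡∂ (2 * n)) p).symm y) := by
  have h := TangentBundle.symmL_trivializationAt (𝕜 := ℝ) (I := 𝓡∂ (2 * n))
    (symm_mem_chart_source hy)
  -- The formula `h` takes the derivative at the chart image of the point with coordinates `y`,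
  -- which is only propositionally `y`. Typing both derivatives as maps of the model space lets the
  -- equality be substituted without transport between fibres.
  have h' : ∀ y', y' = y →
      (mfderivWithin 𝓘(ℝ, EuclideanSpace ℝ (Fin (2 * n))) (𝓡∂ (2 * n))
        (extChartAt (𝓡∂ (2 * n)) p).symm (range (𝓡∂ (2 * n))) y' :
          EuclideanSpace ℝ (Fin (2 * n)) →L[ℝ] EuclideanSpace ℝ (Fin (2 * n))) (stdVec n i) =
      (mfderivWithin 𝓘(ℝ, EuclideanSpace ℝ (Fin (2 * n))) (𝓡∂ (2 * n))
        (extChartAt (𝓡∂ (2 * n)) p).symm (range (𝓡∂ (2 * n))) y :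
          EuclideanSpace ℝ (Fin (2 * n)) →L[ℝ] EuclideanSpace ℝ (Fin (2 * n))) (stdVec n i) := by
    rintro _ rfl; rfl
  have h2 := h' _ ((extChartAt (𝓡∂ (2 * n)) p).right_inv hy)
  exact (Eq.trans (congrArg (fun L : EuclideanSpace ℝ (Fin (2 * n)) →L[ℝ]
    EuclideanSpace ℝ (Fin (2 * n)) ↦ L (stdVec n i)) h) h2).symm

/-- In the tangent bundle trivialization at `p` this section is the constant `stdVec n i`. -/
lemma contMDiffOn_coordSection (p : M) (i : Fin (2 * n)) :
    ContMDiffOn (𝓡∂ (2 * n)) ((𝓡∂ (2 * n)).prod 𝓘(ℝ, EuclideanSpace ℝ (Fin (2 * n)))) ∞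
      (fun x : M ↦ Bundle.TotalSpace.mk' (EuclideanSpace ℝ (Fin (2 * n))) x (coordSection p i x))
      (chartAt (EuclideanHalfSpace (2 * n)) p).source := by
  have h := (trivializationAt (EuclideanSpace ℝ (Fin (2 * n)))
    (TangentSpace (𝓡∂ (2 * n)) (M := M)) p).contMDiffOn_section_baseSet_iff (n := ∞)
    (IB := 𝓡∂ (2 * n)) (s := coordSection p i)
  rw [TangentBundle.trivializationAt_baseSet] at h
  refine h.2 ((contMDiffOn_const (c := stdVec n i)).congr fun x hx ↦ ?_)
  have hx' : x ∈ (trivializationAt (EuclideanSpace ℝ (Fin (2 * n)))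
    (TangentSpace (𝓡∂ (2 * n)) (M := M)) p).baseSet := by
    rwa [TangentBundle.trivializationAt_baseSet]
  rw [coordSection, Bundle.Trivialization.symmL_apply _ hx',
    Bundle.Trivialization.apply_mk_symm _ hx']

/-- Smoothness is obtained on `M`, where the metric and the coordinate fields are smooth sections,
and then pulled back along the inverse chart. -/
lemma contDiffOn_metricCoord (g : Metric n M) (p : M) (i j : Fin (2 * n)) :
    ContDiffOn ℝ ∞ (fun y ↦ metricCoord g p y i j) (extChartAt (𝓡∂ (2 * n)) p).target := by
  have h : ContMDiffOn (𝓡∂ (2 * n)) 𝓘(ℝ, ℝ) ∞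
      (fun x : M ↦ g.inner x (coordSection p i x) (coordSection p j x))
      (chartAt (EuclideanHalfSpace (2 * n)) p).source := by
    intro x hx
    have : ContMDiffWithinAt (𝓡∂ (2 * n)) ((𝓡∂ (2 * n)).prod 𝓘(ℝ)) ∞
      (fun x ↦ Bundle.TotalSpace.mk' ℝ (E := Bundle.Trivial M ℝ) x
        (g.inner x (coordSection p i x) (coordSection p j x)))
        (chartAt (EuclideanHalfSpace (2 * n)) p).source x := by
      apply ContMDiffWithinAt.clm_bundle_apply₂ (F₁ := EuclideanSpace ℝ (Fin (2 * n)))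
        (F₂ := EuclideanSpace ℝ (Fin (2 * n)))
      · exact (g.contMDiff x).contMDiffWithinAt
      · exact contMDiffOn_coordSection p i x hx
      · exact contMDiffOn_coordSection p j x hx
    simp only [Bundle.contMDiffWithinAt_totalSpace] at this
    exact this.2
  have h2 := h.comp (contMDiffOn_extChartAt_symm (n := ∞) (I := 𝓡∂ (2 * n)) p)
    fun y hy ↦ symm_mem_chart_source hy
  refine (contMDiffOn_iff_contDiffOn.1 h2).congr fun y hy ↦ ?_
  simp only [metricCoord, Matrix.of_apply, Function.comp_apply, coordVec_eq_coordSection hy]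

lemma contDiffOn_complexCoord (S : ComplexStructure n M) (p : M) (k j : Fin (2 * n)) :
    ContDiffOn ℝ ∞ (complexCoord S p k j) (extChartAt (𝓡∂ (2 * n)) p).target := by
  have h : ContMDiffOn (𝓡∂ (2 * n)) 𝓘(ℝ, EuclideanSpace ℝ (Fin (2 * n))) ∞
      (fun x : M ↦ (trivializationAt (EuclideanSpace ℝ (Fin (2 * n)))
        (TangentSpace (𝓡∂ (2 * n)) (M := M)) p ⟨x, S.J x (coordSection p j x)⟩).2)
      (chartAt (EuclideanHalfSpace (2 * n)) p).source := by
    have h := (trivializationAt (EuclideanSpace ℝ (Fin (2 * n)))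
      (TangentSpace (𝓡∂ (2 * n)) (M := M)) p).contMDiffOn_section_baseSet_iff (n := ∞)
      (IB := 𝓡∂ (2 * n)) (s := fun x ↦ S.J x (coordSection p j x))
    rw [TangentBundle.trivializationAt_baseSet] at h
    refine h.1 fun x hx ↦ ?_
    exact ContMDiffWithinAt.clm_bundle_apply (S.smooth x).contMDiffWithinAt
      (contMDiffOn_coordSection p j x hx)
  have h2 := h.comp (contMDiffOn_extChartAt_symm (n := ∞) (I := 𝓡∂ (2 * n)) p)
    fun y hy ↦ symm_mem_chart_source hy
  have h3 : ContDiffOn ℝ ∞ (fun y ↦ (trivializationAt (EuclideanSpace ℝ (Fin (2 * n)))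
        (TangentSpace (𝓡∂ (2 * n)) (M := M)) p
        ⟨(extChartAt (𝓡∂ (2 * n)) p).symm y, S.J _ (coordSection p j _)⟩).2 k)
        (extChartAt (𝓡∂ (2 * n)) p).target :=
    (EuclideanSpace.proj k : EuclideanSpace ℝ (Fin (2 * n)) →L[ℝ] ℝ).contDiff.comp_contDiffOn
      (contMDiffOn_iff_contDiffOn.1 h2)
  refine h3.congr fun y hy ↦ ?_
  have hy' := symm_mem_chart_source hy
  have hb : (extChartAt (𝓡∂ (2 * n)) p).symm y ∈ (trivializationAt (EuclideanSpace ℝ (Fin (2 * n)))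
    (TangentSpace (𝓡∂ (2 * n)) (M := M)) p).baseSet := by
    rwa [TangentBundle.trivializationAt_baseSet]
  simp only [complexCoord, differential, coordVec_eq_coordSection hy]
  rw [← TangentBundle.continuousLinearMapAt_trivializationAt hy',
    Bundle.Trivialization.continuousLinearMapAt_apply,
    Bundle.Trivialization.linearMapAt_apply, if_pos hb]

end coordinates

end KahlerCalderon

end

noncomputable section

namespace KahlerCalderon

/-! ### The Cauchy–Riemann equations in coordinates -/

section cauchyRiemann

variable {n : ℕ} [NeZero n] {M : Type*} [TopologicalSpace M]
  [ChartedSpace (EuclideanHalfSpace (2 * n)) M] [IsManifold (𝓡∂ (2 * n)) ∞ M]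

set_option linter.unusedSectionVars false in
lemma eq_sum_stdVec (v : EuclideanSpace ℝ (Fin (2 * n))) : v = ∑ k, v k • stdVec n k := by
  ext i
  simp [Pi.single_apply]

lemma differential_extChartAt_coordVec {p : M} {y : EuclideanSpace ℝ (Fin (2 * n))}
    (hy : y ∈ (extChartAt (𝓡∂ (2 * n)) p).target) (i : Fin (2 * n)) :
    differential (extChartAt (𝓡∂ (2 * n)) p) ((extChartAt (𝓡∂ (2 * n)) p).symm y) (coordVec p y i) =
      stdVec n i :=
  congrArg (fun L : EuclideanSpace ℝ (Fin (2 * n)) →L[ℝ] EuclideanSpace ℝ (Fin (2 * n)) ↦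
    L (stdVec n i)) (mfderiv_extChartAt_comp_mfderivWithin_extChartAt_symm (I := 𝓡∂ (2 * n)) hy)

/-- Expansion of a tangent vector in the coordinate basis. -/
lemma eq_sum_coordVec {p : M} {y : EuclideanSpace ℝ (Fin (2 * n))}
    (hy : y ∈ (extChartAt (𝓡∂ (2 * n)) p).target)
    (v : TangentSpace (𝓡∂ (2 * n)) ((extChartAt (𝓡∂ (2 * n)) p).symm y)) :
    v = ∑ k, differential (F := EuclideanSpace ℝ (Fin (2 * n))) (extChartAt (𝓡∂ (2 * n)) p)
      ((extChartAt (𝓡∂ (2 * n)) p).symm y) v k • coordVec p y k := by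
  have h := congrArg (fun L : TangentSpace (𝓡∂ (2 * n)) ((extChartAt (𝓡∂ (2 * n)) p).symm y) →L[ℝ]
    TangentSpace (𝓡∂ (2 * n)) ((extChartAt (𝓡∂ (2 * n)) p).symm y) ↦ L v)
    (mfderivWithin_extChartAt_symm_comp_mfderiv_extChartAt (I := 𝓡∂ (2 * n)) hy)
  refine h.symm.trans ?_
  set w : EuclideanSpace ℝ (Fin (2 * n)) :=
    differential (F := EuclideanSpace ℝ (Fin (2 * n))) (extChartAt (𝓡∂ (2 * n)) p)
      ((extChartAt (𝓡∂ (2 * n)) p).symm y) v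
  change (mfderivWithin 𝓘(ℝ, EuclideanSpace ℝ (Fin (2 * n))) (𝓡∂ (2 * n))
    (extChartAt (𝓡∂ (2 * n)) p).symm (range (𝓡∂ (2 * n))) y) w = _
  conv_lhs => rw [eq_sum_stdVec w]
  exact (map_sum _ _ _).trans (Finset.sum_congr rfl fun k _ ↦ map_smul _ _ _)

lemma J_coordVec (S : ComplexStructure n M) {p : M} {y : EuclideanSpace ℝ (Fin (2 * n))}
    (hy : y ∈ (extChartAt (𝓡∂ (2 * n)) p).target) (j : Fin (2 * n)) :
    S.J _ (coordVec p y j) = ∑ k, complexCoord S p k j y • coordVec p y k :=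
  eq_sum_coordVec hy _

/-- The matrix of `J` in the preferred chart around `p`. -/
def complexMatrix (S : ComplexStructure n M) (p : M) (y : EuclideanSpace ℝ (Fin (2 * n))) :
    Matrix (Fin (2 * n)) (Fin (2 * n)) ℝ :=
  Matrix.of fun k j ↦ complexCoord S p k j y

lemma complexMatrix_mul_self (S : ComplexStructure n M) {p : M}
    {y : EuclideanSpace ℝ (Fin (2 * n))} (hy : y ∈ (extChartAt (𝓡∂ (2 * n)) p).target) :
    complexMatrix S p y * complexMatrix S p y = -1 := by
  ext m j
  have h := S.J_sq _ (coordVec p y j)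
  rw [J_coordVec S hy, map_sum] at h
  simp only [map_smul] at h
  have h2 := congrArg (fun v ↦ (differential (extChartAt (𝓡∂ (2 * n)) p)
    ((extChartAt (𝓡∂ (2 * n)) p).symm y) v : EuclideanSpace ℝ (Fin (2 * n))) m) h
  simp only [map_sum, map_smul, map_neg, differential_extChartAt_coordVec hy] at h2
  simp only [Matrix.mul_apply, complexMatrix, Matrix.of_apply, Matrix.neg_apply]
  have h3 : (∑ k, complexCoord S p k j y • differential (extChartAt (𝓡∂ (2 * n)) p)
    ((extChartAt (𝓡∂ (2 * n)) p).symm y) (S.J _ (coordVec p y k)) :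
      EuclideanSpace ℝ (Fin (2 * n))) m = ∑ k, complexCoord S p k j y * complexCoord S p m k y := by
    simp [complexCoord]
  rw [h3] at h2
  rw [Finset.sum_congr rfl fun k _ ↦ mul_comm _ _, h2]
  simp [Matrix.one_apply]

lemma metricCoord_isSymm (g : Metric n M) (p : M) (y : EuclideanSpace ℝ (Fin (2 * n))) :
    (metricCoord g p y).IsSymm := by
  ext i j
  exact g.symm _ _ _

lemma complexMatrix_metricCoord {S : ComplexStructure n M} {g : Metric n M} (hg : IsKahler S g)
    {p : M} {y : EuclideanSpace ℝ (Fin (2 * n))} (hy : y ∈ (extChartAt (𝓡∂ (2 * n)) p).target) :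
    (complexMatrix S p y).transpose * metricCoord g p y * complexMatrix S p y =
      metricCoord g p y := by
  ext i j
  have h := hg.compatible _ (coordVec p y i) (coordVec p y j)
  rw [J_coordVec S hy, J_coordVec S hy] at h
  simp only [map_sum, map_smul, sum_apply, smul_apply, smul_eq_mul] at h
  simp only [Matrix.mul_apply, complexMatrix, Matrix.of_apply, Matrix.transpose_apply]
  refine Eq.trans ?_ h
  refine Finset.sum_congr rfl fun k _ ↦ ?_
  rw [mul_comm]
  congr 1

lemma differential_coordVec {u : M → ℂ} (hu : Smooth n u) {p : M}
    {y : EuclideanSpace ℝ (Fin (2 * n))} (hy : y ∈ (extChartAt (𝓡∂ (2 * n)) p).target)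
    (i : Fin (2 * n)) :
    differential u ((extChartAt (𝓡∂ (2 * n)) p).symm y) (coordVec p y i) =
      partialDeriv n i (fun x ↦ u ((extChartAt (𝓡∂ (2 * n)) p).symm x)) y := by
  have hU : UniqueMDiffWithinAt 𝓘(ℝ, EuclideanSpace ℝ (Fin (2 * n))) (range (𝓡∂ (2 * n))) y :=
    (𝓡∂ (2 * n)).uniqueMDiffOn _ (extChartAt_target_subset_range p hy)
  have h := mfderiv_comp_mfderivWithin (I := 𝓘(ℝ, EuclideanSpace ℝ (Fin (2 * n))))
    (I' := 𝓡∂ (2 * n)) (I'' := 𝓘(ℝ, ℂ)) y (f := (extChartAt (𝓡∂ (2 * n)) p).symm) (g := u)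
    ((hu.mdifferentiable (by simp)) _) (mdifferentiableWithinAt_extChartAt_symm hy) hU
  rw [mfderivWithin_eq_fderivWithin] at h
  exact (congrArg (fun L : EuclideanSpace ℝ (Fin (2 * n)) →L[ℝ] ℂ ↦ L (stdVec n i)) h).symm

lemma contDiffWithinAt_comp_symm {u : M → ℂ} (hu : Smooth n u) {p : M}
    {y : EuclideanSpace ℝ (Fin (2 * n))} (hy : y ∈ (extChartAt (𝓡∂ (2 * n)) p).target) :
    ContDiffWithinAt ℝ ∞ (fun x ↦ u ((extChartAt (𝓡∂ (2 * n)) p).symm x))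
      (range (𝓡∂ (2 * n))) y := by
  have h := hu.comp_contMDiffOn (contMDiffOn_extChartAt_symm (n := ∞) (I := 𝓡∂ (2 * n)) p)
  exact ((contMDiffOn_iff_contDiffOn.1 h) y hy).mono_of_mem_nhdsWithin
    (extChartAt_target_mem_nhdsWithin_of_mem hy)

lemma contDiffWithinAt_partialDeriv {u : M → ℂ} (hu : Smooth n u) {p : M}
    {y : EuclideanSpace ℝ (Fin (2 * n))} (hy : y ∈ (extChartAt (𝓡∂ (2 * n)) p).target)
    (i : Fin (2 * n)) :
    ContDiffWithinAt ℝ ∞ (partialDeriv n i (fun x ↦ u ((extChartAt (𝓡∂ (2 * n)) p).symm x)))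
      (range (𝓡∂ (2 * n))) y :=
  ((contDiffWithinAt_comp_symm hu hy).fderivWithin_right (m := ∞) (𝓡∂ (2 * n)).uniqueDiffOn
    (by simp) (extChartAt_target_subset_range p hy)).clm_apply contDiffWithinAt_const

/-- Whether a point is interior can be tested in any chart of the atlas, so the chart around `p` may
be used in place of the preferred chart at the point itself. -/
lemma symm_mem_interior {p : M} {y : EuclideanSpace ℝ (Fin (2 * n))}
    (hy : y ∈ (extChartAt (𝓡∂ (2 * n)) p).target) (hy' : y ∈ interior (range (𝓡∂ (2 * n)))) :
    (extChartAt (𝓡∂ (2 * n)) p).symm y ∈ (𝓡∂ (2 * n)).interior M := by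
  have hs := symm_mem_chart_source hy
  refine ((𝓡∂ (2 * n)).isInteriorPoint_iff_of_mem_atlas (n := ∞) (by simp)
    (chart_mem_atlas _ p) hs).2 ?_
  refine OpenPartialHomeomorph.mem_interior_extend_target _ ?_ ?_
  · exact (chartAt _ p).map_source hs
  · change extChartAt (𝓡∂ (2 * n)) p ((extChartAt (𝓡∂ (2 * n)) p).symm y) ∈ _
    rwa [(extChartAt (𝓡∂ (2 * n)) p).right_inv hy]

/-- The Cauchy–Riemann equations in a chart, up to the boundary. -/
lemma sum_complexCoord_mul_partialDeriv {S : ComplexStructure n M} {u : M → ℂ}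
    (hu : u ∈ S.holomorphicFunctions) {p : M} {y : EuclideanSpace ℝ (Fin (2 * n))}
    (hy : y ∈ (extChartAt (𝓡∂ (2 * n)) p).target) (j : Fin (2 * n)) :
    ∑ k, (complexCoord S p k j y : ℂ) *
        partialDeriv n k (fun x ↦ u ((extChartAt (𝓡∂ (2 * n)) p).symm x)) y =
      Complex.I * partialDeriv n j (fun x ↦ u ((extChartAt (𝓡∂ (2 * n)) p).symm x)) y := by
  -- Holomorphy is only known in the interior. Interior coordinates accumulate at `y` even when `y`
  -- is on the boundary, and both sides are continuous there, so the identity extends.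
  set s := (extChartAt (𝓡∂ (2 * n)) p).target ∩ interior (range (𝓡∂ (2 * n)))
  have hcl : y ∈ closure s := by
    have h1 := (𝓡∂ (2 * n)).range_subset_closure_interior (extChartAt_target_subset_range p hy)
    rw [mem_closure_iff_nhdsWithin_neBot] at h1 ⊢
    have h2 : 𝓝[interior (range (𝓡∂ (2 * n)))] y ≤ 𝓝[s] y := by
      refine le_inf inf_le_left (Filter.le_principal_iff.2 (Filter.inter_mem ?_
        self_mem_nhdsWithin))
      exact nhdsWithin_mono _ interior_subset (extChartAt_target_mem_nhdsWithin_of_mem hy)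
    exact h1.mono h2
  have hw : ∀ k, ContinuousWithinAt
      (partialDeriv n k (fun x ↦ u ((extChartAt (𝓡∂ (2 * n)) p).symm x))) s y := fun k ↦
    (contDiffWithinAt_partialDeriv hu.1 hy k).continuousWithinAt.mono
      (inter_subset_right.trans interior_subset)
  have hC : ∀ k, ContinuousWithinAt (fun y ↦ (complexCoord S p k j y : ℂ)) s y := fun k ↦
    (Complex.continuous_ofReal.continuousAt.comp_continuousWithinAt
      ((contDiffOn_complexCoord S p k j).continuousOn y hy)).mono inter_subset_left
  have hL : ContinuousWithinAt (fun y ↦ ∑ k, (complexCoord S p k j y : ℂ) *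
        partialDeriv n k (fun x ↦ u ((extChartAt (𝓡∂ (2 * n)) p).symm x)) y) s y :=
    tendsto_finsetSum _ fun k _ ↦ (hC k).mul (hw k)
  have hR : ContinuousWithinAt (fun y ↦ Complex.I *
      partialDeriv n j (fun x ↦ u ((extChartAt (𝓡∂ (2 * n)) p).symm x)) y) s y :=
    continuousWithinAt_const.mul (hw j)
  have : (𝓝[s] y).NeBot := mem_closure_iff_nhdsWithin_neBot.1 hcl
  refine tendsto_nhds_unique_of_eventuallyEq hL hR ?_
  filter_upwards [self_mem_nhdsWithin] with z hz
  have h := hu.2 _ (symm_mem_interior hz.1 hz.2) (coordVec p z j)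
  rw [J_coordVec S hz.1, map_sum, differential_coordVec hu.1 hz.1] at h
  simp only [map_smul, differential_coordVec hu.1 hz.1] at h
  rw [← h]
  exact Finset.sum_congr rfl fun k _ ↦ (Complex.real_smul).symm

end cauchyRiemann

end KahlerCalderon

end

noncomputable section

namespace KahlerCalderon

/-! ### Holomorphic functions are harmonic for Kähler metrics -/

section harmonic

variable {n : ℕ} [NeZero n] {M : Type*} [TopologicalSpace M]
  [ChartedSpace (EuclideanHalfSpace (2 * n)) M] [IsManifold (𝓡∂ (2 * n)) ∞ M]

lemma metricCoord_posDef (g : Metric n M) {p : M} {y : EuclideanSpace ℝ (Fin (2 * n))}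
    (hy : y ∈ (extChartAt (𝓡∂ (2 * n)) p).target) : (metricCoord g p y).PosDef := by
  refine Matrix.PosDef.of_dotProduct_mulVec_pos ?_ fun v hv ↦ ?_
  · rw [Matrix.IsHermitian, Matrix.conjTranspose_eq_transpose_of_trivial]
    exact metricCoord_isSymm g p y
  · set V := ∑ k, v k • coordVec p y k with hV
    have hV0 : V ≠ 0 := by
      intro h0
      refine hv (funext fun m ↦ ?_)
      have h2 := congrArg (fun w ↦ (differential (extChartAt (𝓡∂ (2 * n)) p)
        ((extChartAt (𝓡∂ (2 * n)) p).symm y) w : EuclideanSpace ℝ (Fin (2 * n))) m) h0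
      simp only [hV, map_sum, map_smul, map_zero, differential_extChartAt_coordVec hy] at h2
      rw [← eq_sum_stdVec (WithLp.toLp 2 v)] at h2
      exact h2
    have h := g.pos _ V hV0
    rw [hV] at h
    simp only [map_sum, map_smul, sum_apply, smul_apply, smul_eq_mul] at h
    simp only [dotProduct, Matrix.mulVec, star_trivial, metricCoord, Matrix.of_apply,
      Finset.mul_sum]
    refine h.trans_eq ?_
    rw [Finset.sum_comm]
    refine Finset.sum_congr rfl fun i _ ↦ ?_
    rw [Finset.mul_sum]
    refine Finset.sum_congr rfl fun j _ ↦ ?_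
    ring

lemma metricCoord_det_pos (g : Metric n M) {p : M} {y : EuclideanSpace ℝ (Fin (2 * n))}
    (hy : y ∈ (extChartAt (𝓡∂ (2 * n)) p).target) : 0 < (metricCoord g p y).det :=
  (metricCoord_posDef g hy).det_pos

/-- The connection is torsion-free; with commuting second partials this makes the covariant Hessian
symmetric. -/
lemma christoffel_symm (g : Metric n M) (p : M) (k i j : Fin (2 * n))
    (y : EuclideanSpace ℝ (Fin (2 * n))) : christoffel g p k i j y = christoffel g p k j i y := by
  have h : ∀ x, metricCoord g p x i j = metricCoord g p x j i :=
    fun x ↦ (metricCoord_isSymm g p x).apply j i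
  simp only [christoffel, h]
  congr 1
  refine Finset.sum_congr rfl fun l _ ↦ ?_
  ring

/-- At boundary points the symmetry of second derivatives within the half-space rests on its being
contained in the closure of its interior. -/
lemma partialDeriv_partialDeriv_comm {u : M → ℂ} (hu : Smooth n u) {p : M}
    {y : EuclideanSpace ℝ (Fin (2 * n))} (hy : y ∈ (extChartAt (𝓡∂ (2 * n)) p).target)
    (i j : Fin (2 * n)) :
    partialDeriv n i (partialDeriv n j fun x ↦ u ((extChartAt (𝓡∂ (2 * n)) p).symm x)) y =
      partialDeriv n j (partialDeriv n i fun x ↦ u ((extChartAt (𝓡∂ (2 * n)) p).symm x)) y := by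
  have hr := extChartAt_target_subset_range p hy
  have hsm := contDiffWithinAt_comp_symm hu hy
  have hd : DifferentiableWithinAt ℝ (fderivWithin ℝ
      (fun x ↦ u ((extChartAt (𝓡∂ (2 * n)) p).symm x)) (range (𝓡∂ (2 * n))))
      (range (𝓡∂ (2 * n))) y :=
    (hsm.fderivWithin_right (m := 1) (𝓡∂ (2 * n)).uniqueDiffOn (by norm_cast)
      hr).differentiableWithinAt one_ne_zero
  have key : ∀ a b : Fin (2 * n),
      partialDeriv n a (partialDeriv n b fun x ↦ u ((extChartAt (𝓡∂ (2 * n)) p).symm x)) y =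
      fderivWithin ℝ (fderivWithin ℝ (fun x ↦ u ((extChartAt (𝓡∂ (2 * n)) p).symm x))
        (range (𝓡∂ (2 * n)))) (range (𝓡∂ (2 * n))) y (stdVec n a) (stdVec n b) := by
    intro a b
    have h := (hd.hasFDerivWithinAt.clm_apply (hasFDerivWithinAt_const (stdVec n b) y
      (range (𝓡∂ (2 * n))))).fderivWithin ((𝓡∂ (2 * n)).uniqueDiffOn y hr)
    change fderivWithin ℝ (fun z ↦ fderivWithin ℝ (fun x ↦ u ((extChartAt (𝓡∂ (2 * n)) p).symm x))
        (range (𝓡∂ (2 * n))) z (stdVec n b)) (range (𝓡∂ (2 * n))) y (stdVec n a) = _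
    rw [h]
    simp
  rw [key, key]
  exact (hsm.isSymmSndFDerivWithinAt
    (by rw [minSmoothness_of_isRCLikeNormedField]; exact WithTop.coe_le_coe.2 le_top) (𝓡∂ (2 * n)).uniqueDiffOn
    ((𝓡∂ (2 * n)).range_subset_closure_interior hr) hr) _ _

/-- The Leibniz rule for `∇ᵢ` applied to `du ∘ J = i du`, with `∇J = 0`. Here `C` is `J`, `dC` and
`D` are the `i`-th partials of `J` and of `w = du`; `hpar` trades `dC` for Christoffel terms, which
complete `D` to a covariant derivative. -/
lemma sum_covariantHessian_mul {ι : Type*} [Fintype ι] (C dC : ι → ι → ℂ) (Γ : ι → ι → ι → ℂ)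
    (D w : ι → ℂ) (i j : ι)
    (hpar : ∀ k, dC k j + ∑ l, (Γ k i l * C l j - Γ l i j * C k l) = 0)
    (hw : ∀ l, ∑ k, C k l * w k = Complex.I * w l)
    (hD : ∑ k, (dC k j * w k + C k j * D k) = Complex.I * D j) :
    ∑ k, (D k - ∑ l, Γ l i k * w l) * C k j = Complex.I * (D j - ∑ k, Γ k i j * w k) := by
  have h1 : ∑ k, dC k j * w k =
      -(∑ k, ∑ l, Γ k i l * C l j * w k) + ∑ l, Γ l i j * (Complex.I * w l) := by
    have h2 : ∑ l, Γ l i j * (Complex.I * w l) = ∑ k, ∑ l, Γ l i j * C k l * w k := by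
      rw [Finset.sum_comm]
      refine Finset.sum_congr rfl fun l _ ↦ ?_
      rw [← hw, Finset.mul_sum]
      simp only [mul_assoc]
    rw [h2, ← Finset.sum_neg_distrib, ← Finset.sum_add_distrib]
    refine Finset.sum_congr rfl fun k _ ↦ ?_
    rw [eq_neg_of_add_eq_zero_left (hpar k), Finset.sum_sub_distrib, neg_sub, sub_mul,
      Finset.sum_mul, Finset.sum_mul]
    ring
  have h3 : ∑ k, (∑ l, Γ l i k * w l) * C k j = ∑ k, ∑ l, Γ k i l * C l j * w k := by
    rw [Finset.sum_comm]
    refine Finset.sum_congr rfl fun k _ ↦ ?_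
    rw [Finset.sum_mul]
    refine Finset.sum_congr rfl fun l _ ↦ ?_
    ring
  have h4 : ∑ l, Γ l i j * (Complex.I * w l) = Complex.I * ∑ k, Γ k i j * w k := by
    rw [Finset.mul_sum]
    refine Finset.sum_congr rfl fun k _ ↦ ?_
    ring
  rw [Finset.sum_add_distrib, h1, h4] at hD
  simp only [sub_mul, Finset.sum_sub_distrib, h3]
  rw [Finset.sum_congr rfl fun k _ ↦ mul_comm (D k) (C k j)]
  linear_combination hD

/-- Holomorphic functions are harmonic with respect to any Kähler metric. -/
theorem laplacian_eq_zero_of_holomorphic {S : ComplexStructure n M} {g : Metric n M}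
    (hg : IsKahler S g) {u : M → ℂ} (hu : u ∈ S.holomorphicFunctions) (p : M) :
    laplacian g u p = 0 := by
  set x := extChartAt (𝓡∂ (2 * n)) p p with hx
  have hxt : x ∈ (extChartAt (𝓡∂ (2 * n)) p).target := mem_extChartAt_target p
  have hxr : x ∈ range (𝓡∂ (2 * n)) := extChartAt_target_subset_range p hxt
  have hun := (𝓡∂ (2 * n)).uniqueDiffOn x hxr
  have htn : (extChartAt (𝓡∂ (2 * n)) p).target ∈ 𝓝[range (𝓡∂ (2 * n))] x :=
    extChartAt_target_mem_nhdsWithin_of_mem hxt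
  set w : Fin (2 * n) → EuclideanSpace ℝ (Fin (2 * n)) → ℂ := fun j ↦
    partialDeriv n j (fun x ↦ u ((extChartAt (𝓡∂ (2 * n)) p).symm x)) with hw
  have hwd : ∀ j, DifferentiableWithinAt ℝ (w j) (range (𝓡∂ (2 * n))) x := fun j ↦
    (contDiffWithinAt_partialDeriv hu.1 hxt j).differentiableWithinAt (by simp)
  have hCd : ∀ k j, DifferentiableWithinAt ℝ (complexCoord S p k j) (range (𝓡∂ (2 * n))) x :=
    fun k j ↦ (((contDiffOn_complexCoord S p k j) x hxt).mono_of_mem_nhdsWithin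
      htn).differentiableWithinAt (by simp)
  have hdiv := sum_fderivWithin_divergence (G := metricCoord g p)
    (fun i j ↦ (((contDiffOn_metricCoord g p i j) x hxt).mono_of_mem_nhdsWithin htn).of_le
      (by simp)) (metricCoord_isSymm g p) hun hxr
    (Filter.mem_of_superset htn fun y hy ↦ (metricCoord_det_pos g hy).ne')
    (metricCoord_det_pos g hxt) (stdVec n) w hwd
  let H : Matrix (Fin (2 * n)) (Fin (2 * n)) ℂ := Matrix.of fun i j ↦
    partialDeriv n i (w j) x - ∑ k, (christoffel g p k i j x : ℂ) * w k x
  have hHs : H.IsSymm := by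
    ext i j
    simp only [H, Matrix.transpose_apply, Matrix.of_apply, christoffel_symm g p _ j i]
    rw [partialDeriv_partialDeriv_comm hu.1 hxt j i]
  have hHJ : H * (complexMatrix S p x).map Complex.ofReal = Complex.I • H := by
    ext i j
    simp only [Matrix.mul_apply, Matrix.smul_apply, H, Matrix.of_apply, Matrix.map_apply,
      complexMatrix, smul_eq_mul]
    refine sum_covariantHessian_mul (fun k l ↦ (complexCoord S p k l x : ℂ))
      (fun k l ↦ ((partialDeriv n i (complexCoord S p k l) x : ℝ) : ℂ))
      (fun k l m ↦ (christoffel g p k l m x : ℂ)) (fun k ↦ partialDeriv n i (w k) x)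
      (fun k ↦ w k x) i j (fun k ↦ ?_) (fun l ↦ sum_complexCoord_mul_partialDeriv hu hxt l) ?_
    · have := hg.parallel p i k j
      rw [covDerivJ] at this
      exact_mod_cast this
    -- The Cauchy–Riemann equations hold on a whole relative neighbourhood of `x` in the half-space,
    -- so they may be differentiated at `x`.
    · have hCR : (fun y ↦ ∑ k, (complexCoord S p k j y : ℂ) * w k y)
          =ᶠ[𝓝[range (𝓡∂ (2 * n))] x] fun y ↦ Complex.I * w j y :=
        Filter.mem_of_superset htn fun y hy ↦ sum_complexCoord_mul_partialDeriv hu hy j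
      have hd1 : ∀ k, HasFDerivWithinAt (fun y ↦ (complexCoord S p k j y : ℂ))
          (Complex.ofRealCLM.comp (fderivWithin ℝ (complexCoord S p k j) (range (𝓡∂ (2 * n))) x))
          (range (𝓡∂ (2 * n))) x := fun k ↦
        Complex.ofRealCLM.hasFDerivAt.comp_hasFDerivWithinAt x (hCd k j).hasFDerivWithinAt
      have hd2 := HasFDerivWithinAt.fun_sum (u := Finset.univ) fun k _ ↦
        (hd1 k).fun_mul (hwd k).hasFDerivWithinAt
      have hd3 := (hwd j).hasFDerivWithinAt.const_mul Complex.I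
      have heq := (hd2.congr_of_eventuallyEq hCR.symm
        (hCR.symm.self_of_nhdsWithin hxr)).fderivWithin hun
      rw [hd3.fderivWithin hun] at heq
      have heq' := congrArg (fun L : EuclideanSpace ℝ (Fin (2 * n)) →L[ℝ] ℂ ↦ L (stdVec n i)) heq
      simp only [smul_apply, sum_apply, add_apply, ContinuousLinearMap.comp_apply,
        Complex.ofRealCLM_apply, smul_eq_mul] at heq'
      refine Eq.trans (Finset.sum_congr rfl fun k _ ↦ ?_) heq'.symm
      simp only [partialDeriv]
      ring
  have hzero := sum_inv_mul_eq_zero_of_mul_eq (metricCoord g p x) (complexMatrix S p x)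
    (metricCoord_det_pos g hxt).ne' (complexMatrix_mul_self S hxt)
    (complexMatrix_metricCoord hg hxt) H hHs hHJ
  rw [laplacian, ← hx]
  have hdiv' := hdiv.trans (congrArg (fun c ↦ (√(metricCoord g p x).det : ℂ) * c) hzero)
  rw [mul_zero] at hdiv'
  exact mul_eq_zero_of_right _ hdiv'

set_option linter.unusedSectionVars false in
lemma partialDeriv_conj (i : Fin (2 * n)) (v : EuclideanSpace ℝ (Fin (2 * n)) → ℂ)
    {y : EuclideanSpace ℝ (Fin (2 * n))} (hy : y ∈ range (𝓡∂ (2 * n))) :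
    partialDeriv n i (fun x ↦ (starRingEnd ℂ) (v x)) y =
      (starRingEnd ℂ) (partialDeriv n i v y) := by
  have h := Complex.conjCLE.comp_fderivWithin (f := v) ((𝓡∂ (2 * n)).uniqueDiffOn y hy)
  exact congrArg (fun L : EuclideanSpace ℝ (Fin (2 * n)) →L[ℝ] ℂ ↦ L (stdVec n i)) h

/-- The operator has real coefficients, so it commutes with conjugation. -/
lemma laplacian_conj (g : Metric n M) (u : M → ℂ) (p : M) :
    laplacian g (fun x ↦ (starRingEnd ℂ) (u x)) p = (starRingEnd ℂ) (laplacian g u p) := by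
  have hxr : extChartAt (𝓡∂ (2 * n)) p p ∈ range (𝓡∂ (2 * n)) :=
    extChartAt_target_subset_range p (mem_extChartAt_target p)
  simp only [laplacian, map_mul, map_neg, map_sum, Complex.conj_ofReal]
  congr 1
  refine Finset.sum_congr rfl fun i _ ↦ Finset.sum_congr rfl fun j _ ↦ ?_
  rw [← partialDeriv_conj i _ hxr]
  unfold partialDeriv
  refine congrArg (fun L : EuclideanSpace ℝ (Fin (2 * n)) →L[ℝ] ℂ ↦ L (stdVec n i))
    (fderivWithin_congr (fun y hy ↦ ?_) ?_)
  · rw [map_mul, Complex.conj_ofReal]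
    exact congrArg _ (partialDeriv_conj j _ hy)
  · rw [map_mul, Complex.conj_ofReal]
    exact congrArg _ (partialDeriv_conj j _ hxr)

end harmonic

end KahlerCalderon

end

noncomputable section

namespace KahlerCalderon

/-! ### The Riemannian volume measure -/

section volume

variable {n : ℕ} [NeZero n] {M : Type*} [TopologicalSpace M]
  [ChartedSpace (EuclideanHalfSpace (2 * n)) M] [IsManifold (𝓡∂ (2 * n)) ∞ M]

lemma eq_sum_coordSection {p x : M} (hx : x ∈ (extChartAt (𝓡∂ (2 * n)) p).source)
    (v : TangentSpace (𝓡∂ (2 * n)) x) :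
    v = ∑ k, differential (F := EuclideanSpace ℝ (Fin (2 * n))) (extChartAt (𝓡∂ (2 * n)) p) x v k •
      coordSection p k x := by
  -- Quantifying over all vectors at the round-trip point allows rewriting that base point to `x`.
  have h : ∀ w : TangentSpace (𝓡∂ (2 * n)) ((extChartAt (𝓡∂ (2 * n)) p).symm
      (extChartAt (𝓡∂ (2 * n)) p x)), w = ∑ k, differential (F := EuclideanSpace ℝ (Fin (2 * n)))
        (extChartAt (𝓡∂ (2 * n)) p) _ w k • coordSection p k _ := fun w ↦ by
    have := eq_sum_coordVec ((extChartAt (𝓡∂ (2 * n)) p).map_source hx) w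
    simpa only [coordVec_eq_coordSection ((extChartAt (𝓡∂ (2 * n)) p).map_source hx)] using this
  rw [(extChartAt (𝓡∂ (2 * n)) p).left_inv hx] at h
  exact h v

/-- The Gram matrix, at `x`, of the coordinate vector fields of the preferred chart around `p`. -/
def gramMatrix (g : Metric n M) (p x : M) : Matrix (Fin (2 * n)) (Fin (2 * n)) ℝ :=
  Matrix.of fun i j ↦ g.inner x (coordSection p i x) (coordSection p j x)

lemma metricCoord_eq_gramMatrix (g : Metric n M) {p : M} {y : EuclideanSpace ℝ (Fin (2 * n))}
    (hy : y ∈ (extChartAt (𝓡∂ (2 * n)) p).target) :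
    metricCoord g p y = gramMatrix g p ((extChartAt (𝓡∂ (2 * n)) p).symm y) := by
  ext i j
  simp only [metricCoord, gramMatrix, Matrix.of_apply, coordVec_eq_coordSection hy]

/-- The Jacobian matrix, at `x`, of the change from the chart around `q` to the chart around
`p`. -/
def jacobianMatrix (p q x : M) : Matrix (Fin (2 * n)) (Fin (2 * n)) ℝ :=
  Matrix.of fun i j ↦ differential (F := EuclideanSpace ℝ (Fin (2 * n)))
    (extChartAt (𝓡∂ (2 * n)) p) x (coordSection q j x) i

/-- Both Gram matrices represent the same bilinear form at `x`, so they are congruent through the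
change of basis. Taking determinants gives the transformation law of the densities. -/
lemma gramMatrix_change (g : Metric n M) {p x : M} (q : M)
    (hx : x ∈ (extChartAt (𝓡∂ (2 * n)) p).source) :
    gramMatrix g q x = (jacobianMatrix p q x).transpose * gramMatrix g p x *
      jacobianMatrix p q x := by
  ext i j
  have h : g.inner x (coordSection q i x) (coordSection q j x) =
    g.inner x (∑ k, jacobianMatrix p q x k i • coordSection p k x)
      (∑ k, jacobianMatrix p q x k j • coordSection p k x) := by
    congr 1
    · exact congrArg _ (eq_sum_coordSection hx _)
    · exact eq_sum_coordSection hx _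
  simp only [map_sum, map_smul, sum_apply, smul_apply, smul_eq_mul] at h
  simp only [Matrix.mul_apply, Matrix.transpose_apply]
  refine h.trans (Finset.sum_congr rfl fun k _ ↦ ?_)
  rw [mul_comm]
  rfl

/-- The change of coordinates from the chart around `q` to the chart around `p`. -/
def coordChange (p q : M) : EuclideanSpace ℝ (Fin (2 * n)) → EuclideanSpace ℝ (Fin (2 * n)) :=
  fun y ↦ extChartAt (𝓡∂ (2 * n)) p ((extChartAt (𝓡∂ (2 * n)) q).symm y)

/-- The derivative of `coordChange`. -/
def coordChangeDeriv (p q : M) (y : EuclideanSpace ℝ (Fin (2 * n))) :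
    EuclideanSpace ℝ (Fin (2 * n)) →L[ℝ] EuclideanSpace ℝ (Fin (2 * n)) :=
  fderivWithin ℝ (coordChange p q) (range (𝓡∂ (2 * n))) y

lemma hasFDerivWithinAt_coordChange {p q : M} {y : EuclideanSpace ℝ (Fin (2 * n))}
    (hy : y ∈ (extChartAt (𝓡∂ (2 * n)) q).target)
    (hx : (extChartAt (𝓡∂ (2 * n)) q).symm y ∈ (extChartAt (𝓡∂ (2 * n)) p).source) :
    HasFDerivWithinAt (coordChange p q) (coordChangeDeriv p q y) (range (𝓡∂ (2 * n))) y := by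
  refine DifferentiableWithinAt.hasFDerivWithinAt ?_
  rw [extChartAt_source] at hx
  have h1 := (mdifferentiableAt_extChartAt (I := 𝓡∂ (2 * n)) hx).comp_mdifferentiableWithinAt y
    (mdifferentiableWithinAt_extChartAt_symm hy)
  exact mdifferentiableWithinAt_iff_differentiableWithinAt.1 h1

lemma coordChangeDeriv_stdVec {p q : M} {y : EuclideanSpace ℝ (Fin (2 * n))}
    (hy : y ∈ (extChartAt (𝓡∂ (2 * n)) q).target)
    (hx : (extChartAt (𝓡∂ (2 * n)) q).symm y ∈ (extChartAt (𝓡∂ (2 * n)) p).source)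
    (j : Fin (2 * n)) :
    coordChangeDeriv p q y (stdVec n j) = differential (F := EuclideanSpace ℝ (Fin (2 * n)))
      (extChartAt (𝓡∂ (2 * n)) p) ((extChartAt (𝓡∂ (2 * n)) q).symm y)
      (coordSection q j ((extChartAt (𝓡∂ (2 * n)) q).symm y)) := by
  rw [← coordVec_eq_coordSection hy]
  have hU : UniqueMDiffWithinAt 𝓘(ℝ, EuclideanSpace ℝ (Fin (2 * n))) (range (𝓡∂ (2 * n))) y :=
    (𝓡∂ (2 * n)).uniqueMDiffOn _ (extChartAt_target_subset_range q hy)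
  rw [extChartAt_source] at hx
  have h := mfderiv_comp_mfderivWithin (I := 𝓘(ℝ, EuclideanSpace ℝ (Fin (2 * n))))
    (I' := 𝓡∂ (2 * n)) (I'' := 𝓘(ℝ, EuclideanSpace ℝ (Fin (2 * n)))) y
    (f := (extChartAt (𝓡∂ (2 * n)) q).symm) (g := extChartAt (𝓡∂ (2 * n)) p)
    (mdifferentiableAt_extChartAt hx) (mdifferentiableWithinAt_extChartAt_symm hy) hU
  rw [mfderivWithin_eq_fderivWithin] at h
  exact congrArg (fun L : EuclideanSpace ℝ (Fin (2 * n)) →L[ℝ] EuclideanSpace ℝ (Fin (2 * n)) ↦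
    L (stdVec n j)) h

lemma det_coordChangeDeriv {p q : M} {y : EuclideanSpace ℝ (Fin (2 * n))}
    (hy : y ∈ (extChartAt (𝓡∂ (2 * n)) q).target)
    (hx : (extChartAt (𝓡∂ (2 * n)) q).symm y ∈ (extChartAt (𝓡∂ (2 * n)) p).source) :
    (coordChangeDeriv p q y).det =
      (jacobianMatrix (n := n) p q ((extChartAt (𝓡∂ (2 * n)) q).symm y)).det := by
  let b := (EuclideanSpace.basisFun (Fin (2 * n)) ℝ).toBasis
  rw [ContinuousLinearMap.det, ← LinearMap.det_toMatrix b]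
  congr 1
  ext i j
  rw [LinearMap.toMatrix_apply]
  simp only [b, OrthonormalBasis.coe_toBasis, EuclideanSpace.basisFun_apply,
    OrthonormalBasis.coe_toBasis_repr_apply, EuclideanSpace.basisFun_repr, jacobianMatrix,
    Matrix.of_apply]
  exact congrArg (fun v : EuclideanSpace ℝ (Fin (2 * n)) ↦ v i) (coordChangeDeriv_stdVec hy hx j)

/-- The Riemannian densities of two charts are related by the Jacobian determinant. -/
lemma abs_det_mul_sqrt_det (g : Metric n M) {p q : M} {y : EuclideanSpace ℝ (Fin (2 * n))}
    (hy : y ∈ (extChartAt (𝓡∂ (2 * n)) q).target)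
    (hx : (extChartAt (𝓡∂ (2 * n)) q).symm y ∈ (extChartAt (𝓡∂ (2 * n)) p).source) :
    |(coordChangeDeriv p q y).det| * √(metricCoord g p (coordChange p q y)).det =
      √(metricCoord g q y).det := by
  have hT : coordChange p q y ∈ (extChartAt (𝓡∂ (2 * n)) p).target :=
    (extChartAt (𝓡∂ (2 * n)) p).map_source hx
  have hTs : (extChartAt (𝓡∂ (2 * n)) p).symm (coordChange p q y) =
      (extChartAt (𝓡∂ (2 * n)) q).symm y := (extChartAt (𝓡∂ (2 * n)) p).left_inv hx
  rw [metricCoord_eq_gramMatrix g hy, gramMatrix_change g q hx, metricCoord_eq_gramMatrix g hT,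
    hTs, det_coordChangeDeriv hy hx, Matrix.det_mul, Matrix.det_mul, Matrix.det_transpose,
    mul_right_comm, ← sq, Real.sqrt_mul (sq_nonneg _), Real.sqrt_sq_eq_abs]

set_option linter.unusedSectionVars false in
lemma measurableSet_extChartAt_target (p : M) :
    MeasurableSet (extChartAt (𝓡∂ (2 * n)) p).target := by
  rw [extChartAt_target]
  exact (((chartAt (EuclideanHalfSpace (2 * n)) p).open_target.preimage
    (𝓡∂ (2 * n)).continuous_symm).measurableSet).inter (𝓡∂ (2 * n)).isClosed_range.measurableSet

lemma continuousOn_sqrt_det_metricCoord (g : Metric n M) (p : M) :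
    ContinuousOn (fun y ↦ √(metricCoord g p y).det) (extChartAt (𝓡∂ (2 * n)) p).target :=
  fun y hy ↦ Real.continuous_sqrt.continuousAt.comp_continuousWithinAt
    (contDiffWithinAt_det fun i j ↦ contDiffOn_metricCoord g p i j y hy).continuousWithinAt

variable [MeasurableSpace M] [BorelSpace M]

set_option linter.unusedSectionVars false in
lemma measurableSet_symm_preimage (p : M) {A : Set M} (hA : MeasurableSet A) :
    MeasurableSet ((extChartAt (𝓡∂ (2 * n)) p).symm ⁻¹' A ∩ (extChartAt (𝓡∂ (2 * n)) p).target) := by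
  have h := (measurableSet_extChartAt_target p).subtype_image
    ((continuousOn_extChartAt_symm (I := 𝓡∂ (2 * n)) p).domRestrict.measurable hA)
  convert h using 1
  ext y
  simp [and_comm]

lemma chartVolume_apply (g : Metric n M) (p : M) {A : Set M} (hA : MeasurableSet A) :
    chartVolume g p A = ∫⁻ y in (extChartAt (𝓡∂ (2 * n)) p).symm ⁻¹' A ∩
      (extChartAt (𝓡∂ (2 * n)) p).target, ENNReal.ofReal √(metricCoord g p y).det := by
  have hm := measurableSet_extChartAt_target (n := n) p
  -- The inverse chart is controlled only on the chart target, hence almost-everywhere measurability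
  -- for the restricted measure.
  have h1 : AEMeasurable (extChartAt (𝓡∂ (2 * n)) p).symm
      ((volume : Measure (EuclideanSpace ℝ (Fin (2 * n)))).restrict
        (extChartAt (𝓡∂ (2 * n)) p).target) :=
    (continuousOn_extChartAt_symm p).aemeasurable hm
  rw [chartVolume, Measure.map_apply_of_aemeasurable
    (h1.mono_ac (withDensity_absolutelyContinuous _ _)) hA, withDensity_apply',
    Measure.restrict_restrict' hm]

/-- The volume measures of two charts agree on the overlap of their domains. -/
lemma chartVolume_eq_chartVolume (g : Metric n M) {p q : M} {A : Set M} (hA : MeasurableSet A)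
    (hp : A ⊆ (extChartAt (𝓡∂ (2 * n)) p).source) (hq : A ⊆ (extChartAt (𝓡∂ (2 * n)) q).source) :
    chartVolume g p A = chartVolume g q A := by
  rw [chartVolume_apply g p hA, chartVolume_apply g q hA]
  set B := (extChartAt (𝓡∂ (2 * n)) q).symm ⁻¹' A ∩ (extChartAt (𝓡∂ (2 * n)) q).target with hB
  have himg : (extChartAt (𝓡∂ (2 * n)) p).symm ⁻¹' A ∩ (extChartAt (𝓡∂ (2 * n)) p).target =
      coordChange p q '' B := by
    ext y
    constructor
    · rintro ⟨hyA, hyt⟩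
      refine ⟨extChartAt (𝓡∂ (2 * n)) q ((extChartAt (𝓡∂ (2 * n)) p).symm y), ⟨?_, ?_⟩, ?_⟩
      · rwa [mem_preimage, (extChartAt (𝓡∂ (2 * n)) q).left_inv (hq hyA)]
      · exact (extChartAt (𝓡∂ (2 * n)) q).map_source (hq hyA)
      · rw [coordChange, (extChartAt (𝓡∂ (2 * n)) q).left_inv (hq hyA),
          (extChartAt (𝓡∂ (2 * n)) p).right_inv hyt]
    · rintro ⟨z, ⟨hzA, hzt⟩, rfl⟩
      refine ⟨?_, (extChartAt (𝓡∂ (2 * n)) p).map_source (hp hzA)⟩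
      rwa [mem_preimage, coordChange, (extChartAt (𝓡∂ (2 * n)) p).left_inv (hp hzA)]
  have hinj : InjOn (coordChange p q) B := by
    rintro y ⟨hyA, hyt⟩ z ⟨hzA, hzt⟩ h
    exact (extChartAt (𝓡∂ (2 * n)) q).symm.injOn hyt hzt
      ((extChartAt (𝓡∂ (2 * n)) p).injOn (hp hyA) (hp hzA) h)
  -- Change of variables needs only derivatives within `B`, so boundary points of the half-space
  -- require no separate treatment.
  rw [himg, lintegral_image_eq_lintegral_abs_det_fderiv_mul volume
    (measurableSet_symm_preimage q hA)
    (fun y hy ↦ (hasFDerivWithinAt_coordChange hy.2 (hp hy.1)).mono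
      (inter_subset_right.trans (extChartAt_target_subset_range q))) hinj]
  refine setLIntegral_congr_fun (measurableSet_symm_preimage q hA) fun y hy ↦ ?_
  rw [← ENNReal.ofReal_mul (abs_nonneg _), abs_det_mul_sqrt_det g hy.2 (hp hy.1)]

lemma exists_open_chartVolume_lt_top (g : Metric n M) (x : M) :
    ∃ U : Set M, IsOpen U ∧ x ∈ U ∧ U ⊆ (extChartAt (𝓡∂ (2 * n)) x).source ∧
      chartVolume g x U < ⊤ := by
  have hx := mem_extChartAt_target (I := 𝓡∂ (2 * n)) x
  -- By continuity the density stays below its value at `x` plus 1 on a small ball, which has finite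
  -- Lebesgue measure.
  have hev := (continuousOn_sqrt_det_metricCoord g x _ hx).eventually
    (gt_mem_nhds (lt_add_one (√(metricCoord g x (extChartAt (𝓡∂ (2 * n)) x x)).det)))
  obtain ⟨r, hr, hball⟩ := Metric.mem_nhdsWithin_iff.1 hev
  refine ⟨_, isOpen_extChartAt_preimage' (I := 𝓡∂ (2 * n)) x (Metric.isOpen_ball (ε := r)),
    ⟨mem_extChartAt_source x, Metric.mem_ball_self hr⟩, inter_subset_left, ?_⟩
  rw [chartVolume_apply g x
    (isOpen_extChartAt_preimage' (I := 𝓡∂ (2 * n)) x Metric.isOpen_ball).measurableSet]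
  set B := Metric.ball (extChartAt (𝓡∂ (2 * n)) x x) r ∩ (extChartAt (𝓡∂ (2 * n)) x).target
  have hBm : MeasurableSet B :=
    Metric.isOpen_ball.measurableSet.inter (measurableSet_extChartAt_target x)
  refine (lintegral_mono_set (t := B) ?_).trans_lt ?_
  · rintro y ⟨hy1, hy2⟩
    refine ⟨?_, hy2⟩
    have := hy1.2
    rwa [mem_preimage, (extChartAt (𝓡∂ (2 * n)) x).right_inv hy2] at this
  · refine (setLIntegral_mono' hBm (g := fun _ ↦ ENNReal.ofReal
      (√(metricCoord g x (extChartAt (𝓡∂ (2 * n)) x x)).det + 1)) fun y hy ↦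
      ENNReal.ofReal_le_ofReal (le_of_lt (hball hy))).trans_lt ?_
    rw [setLIntegral_const]
    exact ENNReal.mul_lt_top ENNReal.ofReal_lt_top
      ((measure_mono inter_subset_left).trans_lt measure_ball_lt_top)

lemma chartVolume_source_compl (g : Metric n M) (p : M) :
    chartVolume g p (extChartAt (𝓡∂ (2 * n)) p).sourceᶜ = 0 := by
  rw [chartVolume_apply g p (isOpen_extChartAt_source p).measurableSet.compl]
  have : (extChartAt (𝓡∂ (2 * n)) p).symm ⁻¹' (extChartAt (𝓡∂ (2 * n)) p).sourceᶜ ∩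
      (extChartAt (𝓡∂ (2 * n)) p).target = ∅ := by
    ext y
    simp only [mem_inter_iff, mem_preimage, mem_compl_iff, mem_empty_iff_false, iff_false, not_and]
    exact fun h h' ↦ h ((extChartAt (𝓡∂ (2 * n)) p).map_target h')
  rw [this]
  simp

/-- The supremum runs over possibly infinitely many charts. By compactness finitely many sets of
finite chart volume cover `M`, and since chart volumes agree on overlaps, the sum of these finitely
many measures dominates every chart volume. -/
theorem isFiniteMeasure_riemannianVolume [CompactSpace M] (g : Metric n M) :
    IsFiniteMeasure (riemannianVolume g) := by
  choose U hUo hxU hUs hUf using exists_open_chartVolume_lt_top g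
  obtain ⟨t, ht⟩ := isCompact_univ.elim_finite_subcover U hUo
    (fun x _ ↦ mem_iUnion.2 ⟨x, hxU x⟩)
  let ν : Measure M := ∑ x ∈ t, (chartVolume g x).restrict (U x)
  have hν : ν univ < ⊤ := by
    simp only [ν, Measure.finsetSum_apply, Measure.restrict_apply_univ]
    exact ENNReal.sum_lt_top.2 fun x _ ↦ hUf x
  have hle : riemannianVolume g ≤ ν := by
    refine iSup_le fun p ↦ Measure.le_iff.2 fun A hA ↦ ?_
    have hsm := (isOpen_extChartAt_source (I := 𝓡∂ (2 * n)) p).measurableSet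
    -- A chart volume has no mass outside its domain, so `A` can be cut down to where the comparison
    -- on overlaps applies.
    have h1 : chartVolume g p A = chartVolume g p (A ∩ (extChartAt (𝓡∂ (2 * n)) p).source) := by
      refine le_antisymm ?_ (measure_mono inter_subset_left)
      rw [← measure_inter_add_sdiff A hsm,
        measure_mono_null (s := A \ _) (fun y hy ↦ hy.2) (chartVolume_source_compl g p), add_zero]
    rw [h1]
    have h2 : A ∩ (extChartAt (𝓡∂ (2 * n)) p).source ⊆
        ⋃ x ∈ t, (A ∩ (extChartAt (𝓡∂ (2 * n)) p).source) ∩ U x := by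
      intro y hy
      obtain ⟨x, hx, hyx⟩ := mem_iUnion₂.1 (ht (mem_univ y))
      exact mem_iUnion₂.2 ⟨x, hx, hy, hyx⟩
    refine (measure_mono h2).trans ((measure_biUnion_finset_le _ _).trans ?_)
    simp only [ν, Measure.finsetSum_apply]
    refine Finset.sum_le_sum fun x _ ↦ ?_
    rw [Measure.restrict_apply hA, chartVolume_eq_chartVolume g (q := x)
      ((hA.inter hsm).inter (hUo x).measurableSet) (fun y hy ↦ hy.1.2) (fun y hy ↦ hUs x hy.2)]
    exact measure_mono fun y hy ↦ ⟨hy.1.1, hy.2⟩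
  exact ⟨(hle univ).trans_lt hν⟩

/-- One chart suffices, as the supremum dominates it. Its density is strictly positive, so a null
`U` would have a Lebesgue-null coordinate image. -/
theorem riemannianVolume_pos (g : Metric n M) {U : Set M} (hU : IsOpen U) (hne : U.Nonempty) :
    0 < riemannianVolume g U := by
  obtain ⟨x, hx⟩ := hne
  refine lt_of_lt_of_le ?_ (Measure.le_iff'.1 (le_iSup (chartVolume g) x) U)
  rw [chartVolume_apply g x hU.measurableSet, pos_iff_ne_zero]
  set B := (extChartAt (𝓡∂ (2 * n)) x).symm ⁻¹' U ∩ (extChartAt (𝓡∂ (2 * n)) x).target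
  have hBm : MeasurableSet B := measurableSet_symm_preimage x hU.measurableSet
  intro h0
  have hae : AEMeasurable (fun y ↦ ENNReal.ofReal √(metricCoord g x y).det)
      (volume.restrict B) :=
    (((continuousOn_sqrt_det_metricCoord g x).mono inter_subset_right).aemeasurable
      hBm).ennreal_ofReal
  rw [lintegral_eq_zero_iff' hae] at h0
  have hBz : volume B = 0 := by
    have h1 := (ae_restrict_iff' hBm).1 h0
    refine compl_mem_ae_iff.1 ?_
    filter_upwards [h1] with y hy hyB
    have := hy hyB
    simp only [Pi.zero_apply, ENNReal.ofReal_eq_zero] at this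
    exact absurd this (not_le.2 (Real.sqrt_pos.2 (metricCoord_det_pos g hyB.2)))
  have hnhds : B ∈ 𝓝[range (𝓡∂ (2 * n))] (extChartAt (𝓡∂ (2 * n)) x x) :=
    Filter.inter_mem (mem_nhdsWithin_of_mem_nhds (extChartAt_preimage_mem_nhds (hU.mem_nhds hx)))
      (extChartAt_target_mem_nhdsWithin x)
  -- `B` is only a relative neighbourhood in the half-space when `x` is a boundary point, but it
  -- still contains a nonempty open set of the half-space's interior.
  obtain ⟨V, hVo, hxV, hVB⟩ := mem_nhdsWithin.1 hnhds
  have hcl := (𝓡∂ (2 * n)).range_subset_closure_interior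
    (extChartAt_target_subset_range x (mem_extChartAt_target x))
  have hpos := (hVo.inter isOpen_interior).measure_pos volume (mem_closure_iff.1 hcl V hVo hxV)
  exact hpos.ne' (measure_mono_null (fun y hy ↦ hVB ⟨hy.1, interior_subset hy.2⟩) hBz)

end volume

end KahlerCalderon

end

noncomputable section

namespace KahlerCalderon

/-! ### Density of products of holomorphic and antiholomorphic functions

Both factors are harmonic for a Kähler metric, and by the Stone–Weierstrass theorem the products
span a dense subspace of `C(M)` as soon as the holomorphic functions separate points. The existence
of global charts and the behaviour of `f` at the boundary play no role in this argument. -/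

section density

variable {n : ℕ} [NeZero n] {M : Type*} [TopologicalSpace M]
  [ChartedSpace (EuclideanHalfSpace (2 * n)) M] [IsManifold (𝓡∂ (2 * n)) ∞ M]

lemma one_mem_holomorphicFunctions (S : ComplexStructure n M) :
    (fun _ ↦ 1 : M → ℂ) ∈ S.holomorphicFunctions := by
  refine ⟨contMDiff_const, fun p _ v ↦ ?_⟩
  have h : differential (n := n) (fun _ : M ↦ (1 : ℂ)) p = 0 := mfderiv_const
  simp [h]

lemma mul_mem_holomorphicFunctions (S : ComplexStructure n M) {u v : M → ℂ}
    (hu : u ∈ S.holomorphicFunctions) (hv : v ∈ S.holomorphicFunctions) :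
    (fun x ↦ u x * v x) ∈ S.holomorphicFunctions := by
  refine ⟨contDiff_mul.comp_contMDiff (hu.1.prodMk_space hv.1), fun p hp w ↦ ?_⟩
  have hu' : HasMFDerivAt (𝓡∂ (2 * n)) 𝓘(ℝ, ℂ) u p (differential u p) :=
    (hu.1.mdifferentiable (by simp) p).hasMFDerivAt
  have hv' : HasMFDerivAt (𝓡∂ (2 * n)) 𝓘(ℝ, ℂ) v p (differential v p) :=
    (hv.1.mdifferentiable (by simp) p).hasMFDerivAt
  have h : ∀ w, differential (n := n) (fun x ↦ u x * v x) p w =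
      u p * differential v p w + v p * differential u p w := fun w ↦
    congrArg (fun L : TangentSpace (𝓡∂ (2 * n)) p →L[ℝ] ℂ ↦ L w) (hu'.mul hv').mfderiv
  rw [h, h, hu.2 p hp, hv.2 p hp]
  ring

set_option linter.unusedSectionVars false in
lemma smooth_conj {u : M → ℂ} (hu : Smooth n u) : Smooth n (fun x ↦ (starRingEnd ℂ) (u x)) :=
  Complex.conjCLE.contDiff.comp_contMDiff hu

/-- A continuous linear functional on `C(M)` that annihilates all products of a holomorphic and an
antiholomorphic function is zero, if the holomorphic functions separate points. -/
lemma eq_zero_of_annihilates_holomorphic_mul_conj [CompactSpace M] {S : ComplexStructure n M}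
    (hsep : S.HolomorphicallySeparable) (L : C(M, ℂ) →L[ℂ] ℂ)
    (hL : ∀ u v : C(M, ℂ), ⇑u ∈ S.holomorphicFunctions → ⇑v ∈ S.holomorphicFunctions →
      L (u * star v) = 0) : L = 0 := by
  let s : Set C(M, ℂ) := {u | ⇑u ∈ S.holomorphicFunctions}
  have h1s : (1 : C(M, ℂ)) ∈ s := one_mem_holomorphicFunctions S
  have hms : ∀ u v : C(M, ℂ), u ∈ s → v ∈ s → u * v ∈ s := fun u v hu hv ↦
    mul_mem_holomorphicFunctions S hu hv
  let A := StarAlgebra.adjoin ℂ s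
  have hA : A.topologicalClosure = ⊤ := by
    refine ContinuousMap.starSubalgebra_topologicalClosure_eq_top_of_separatesPoints A ?_
    intro x y hxy
    obtain ⟨u, hu, hne⟩ := hsep x y hxy
    exact ⟨u, ⟨⟨u, hu.1.continuous⟩, StarAlgebra.subset_adjoin ℂ s hu, rfl⟩, hne⟩
  have hker : ∀ φ ∈ A, L φ = 0 := by
    intro φ hφ
    have hφ' : φ ∈ Submodule.span ℂ (Submonoid.closure (s ∪ star s) : Set C(M, ℂ)) := by
      rw [← Algebra.adjoin_eq_span]
      exact hφ
    refine Submodule.span_induction (p := fun φ _ ↦ L φ = 0) (fun φ hφ ↦ ?_) (map_zero L)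
      (fun a b _ _ ha hb ↦ by rw [map_add, ha, hb, add_zero])
      (fun c a _ ha ↦ by rw [map_smul, ha, smul_zero]) hφ'
    -- By commutativity the holomorphic and the antiholomorphic factors of a monomial can be
    -- collected separately, and `s` is closed under products.
    obtain ⟨u, hu, v, hv, rfl⟩ : ∃ u ∈ s, ∃ v ∈ s, φ = u * star v := by
      refine Submonoid.closure_induction (motive := fun φ _ ↦ ∃ u ∈ s, ∃ v ∈ s, φ = u * star v)
        ?_ ⟨1, h1s, 1, h1s, by simp⟩ ?_ hφ
      · rintro ψ (hψ | hψ)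
        · exact ⟨ψ, hψ, 1, h1s, by simp⟩
        · exact ⟨1, h1s, star ψ, hψ, by simp⟩
      · rintro _ _ _ _ ⟨u, hu, v, hv, rfl⟩ ⟨u', hu', v', hv', rfl⟩
        exact ⟨u * u', hms _ _ hu hu', v * v', hms _ _ hv hv', by rw [star_mul]; ring⟩
    exact hL u v hu hv
  ext φ
  have hφ : φ ∈ closure (A : Set C(M, ℂ)) := by
    have h : φ ∈ A.topologicalClosure := hA ▸ StarSubalgebra.mem_top
    exact h
  exact closure_minimal hker (isClosed_eq L.continuous continuous_const) hφ

/-- Integration against the continuous function `f`. -/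
def integralFunctional [CompactSpace M] [MeasurableSpace M] [BorelSpace M] (μ : Measure M)
    [IsFiniteMeasure μ] (f : C(M, ℂ)) : C(M, ℂ) →L[ℂ] ℂ :=
  LinearMap.mkContinuous
    { toFun := fun φ ↦ ∫ x, f x * φ x ∂μ
      map_add' := fun φ ψ ↦ by
        have hi : ∀ φ : C(M, ℂ), Integrable (fun x ↦ f x * φ x) μ := fun φ ↦
          (f.continuous.mul φ.continuous).integrable_of_hasCompactSupport
            (HasCompactSupport.of_compactSpace _)
        rw [← integral_add (hi φ) (hi ψ)]
        simp [mul_add]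
      map_smul' := fun c φ ↦ by
        simp only [ContinuousMap.smul_apply, smul_eq_mul, RingHom.id_apply, mul_left_comm _ c]
        exact integral_const_mul _ _ }
    (‖f‖ * μ.real univ) fun φ ↦ by
      refine (norm_integral_le_of_norm_le_const (C := ‖f‖ * ‖φ‖)
        (Filter.Eventually.of_forall fun x ↦ ?_)).trans_eq (by ring)
      rw [norm_mul]
      exact mul_le_mul (f.norm_coe_le_norm x) (φ.norm_coe_le_norm x) (norm_nonneg _)
        (norm_nonneg _)

end density

end KahlerCalderon

end


/-! ### Vanishing of `f` -/

theorem mainTheorem1 (n : ℕ) [NeZero n] (M : Type*) [TopologicalSpace M] [T2Space M]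
    [CompactSpace M] [ChartedSpace (EuclideanHalfSpace (2 * n)) M]
    [IsManifold (𝓡∂ (2 * n)) ∞ M] [MeasurableSpace M] [BorelSpace M]
    (S : KahlerCalderon.ComplexStructure n M)
    (hsep : S.HolomorphicallySeparable) (hchart : S.HasGlobalHolomorphicCharts)
    (g : KahlerCalderon.Metric n M) (hg : KahlerCalderon.IsKahler S g)
    (f : M → ℂ) (hf : KahlerCalderon.Smooth n f)
    (hf_bdry : KahlerCalderon.VanishesToInfiniteOrderAtBoundary n f)
    (horth : ∀ u₁ u₂ : M → ℂ, KahlerCalderon.Smooth n u₁ → KahlerCalderon.Smooth n u₂ →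
      (∀ p, KahlerCalderon.laplacian g u₁ p = 0) →
      (∀ p, KahlerCalderon.laplacian g u₂ p = 0) →
      ∫ x, f x * u₁ x * u₂ x ∂(KahlerCalderon.riemannianVolume g) = 0) :
    ∀ x, f x = 0 := by
  have hfin := KahlerCalderon.isFiniteMeasure_riemannianVolume g
  let F : C(M, ℂ) := ⟨f, hf.continuous⟩
  have hL : KahlerCalderon.integralFunctional (KahlerCalderon.riemannianVolume g) F = 0 := by
    refine KahlerCalderon.eq_zero_of_annihilates_holomorphic_mul_conj hsep _ fun u v hu hv ↦ ?_
    refine Eq.trans (integral_congr_ae (Filter.Eventually.of_forall fun x ↦ ?_))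
      (horth u (fun x ↦ (starRingEnd ℂ) (v x)) hu.1 (KahlerCalderon.smooth_conj hv.1)
        (KahlerCalderon.laplacian_eq_zero_of_holomorphic hg hu) fun p ↦ ?_)
    · exact (mul_assoc _ _ _).symm
    · rw [KahlerCalderon.laplacian_conj, KahlerCalderon.laplacian_eq_zero_of_holomorphic hg hv,
        map_zero]
  -- The functional is zero on all of C(M), in particular at the conjugate of `f`.
  have hint : ∫ x, Complex.normSq (f x) ∂(KahlerCalderon.riemannianVolume g) = 0 := by
    have h : ∫ x, f x * (starRingEnd ℂ) (f x) ∂(KahlerCalderon.riemannianVolume g) = 0 :=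
      DFunLike.congr_fun hL (star F)
    simp only [Complex.mul_conj, integral_complex_ofReal] at h
    exact_mod_cast h
  have hcont : Continuous fun x ↦ Complex.normSq (f x) :=
    Complex.continuous_normSq.comp hf.continuous
  -- Integrability, from continuity on a compact space of finite volume, is essential: the integral
  -- of a non-integrable function is 0 by convention.
  rw [integral_eq_zero_iff_of_nonneg (fun x ↦ Complex.normSq_nonneg _)
    (hcont.integrable_of_hasCompactSupport (HasCompactSupport.of_compactSpace _))] at hint
  by_contra! hne
  refine (KahlerCalderon.riemannianVolume_pos g (isOpen_ne_fun hf.continuous continuous_const)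
    hne).ne' ?_
  refine compl_mem_ae_iff.1 ?_
  filter_upwards [hint] with x hx h
  exact h (Complex.normSq_eq_zero.1 hx)
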